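/- Let $m,p,K$ be natural numbers. Consider hidden states $\mathbf x_k\in\mathbb R^m$, observations $\mathbf y_k\in\mathbb R^p$ and regimes $r_k\in\{1,\dots,K\}$, $k\ge 0$, and put $\mathbf z_k=(\mathbf x_k,\mathbf y_k)$. Let $\mathcal N(\cdot;\mathbf m;\mathbf P)$ be the Gaussian density with mean $\mathbf m$ and covariance $\mathbf P$. A \emph{conditional linear and Gaussian pairwise Markov chain (PMC) with jumps} is a model in which, for every $k$, the joint density is $$p(\mathbf z_{0:k},r_{0:k})=p(r_0)\prod_{i=1}^k p(r_i\mid r_{i-1})\;p(\mathbf z_0\mid r_0)\prod_{i=1}^k p(\mathbf z_i\mid \mathbf z_{i-1},r_{i-1},r_i),\qquad p(\mathbf z_i\mid\mathbf z_{i-1},r_{i-1},r_i)=\mathcal N(\mathbf z_i;\mathbf B_i(r_{i-1:i})\mathbf z_{i-1};\mathbf\Sigma_i(r_{i-1:i}))$$ with matrices $\mathbf B_i(r_{i-1:i})$ and positive definite matrices $\mathbf\Sigma_i(r_{i-1:i})$. Here $p(r_0)$ and $p(r_i\mid r_{i-1})$ are probabilities, and $p(\mathbf z_0\mid r_0)$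 is a probability density (for instance Gaussian) with $\int (1+|\mathbf x_0|^2)\,p(\mathbf x_0,\mathbf y_0\mid r_0)\,d\mathbf x_0<\infty$ for all $\mathbf y_0,r_0$. Conditional densities, probabilities and expectations are defined by quotients of marginals of the joint density, with the convention that a quotient with denominator $0$ is $0$. Suppose that, for every $k\ge1$, the density of $\mathbf y_k$ given $(\mathbf z_{k-1},r_{k-1:k})$ does not depend on $\mathbf x_{k-1}$ (write it $p(\mathbf y_k\mid\mathbf y_{k-1},r_{k-1:k})$), and that $$p(\mathbf x_k\mid\mathbf z_{k-1},\mathbf y_k,r_{k-1:k})=\mathcal N\big(\mathbf x_k;\ \mathbf C_k\mathbf x_{k-1}+\mathbf D_k;\ \mathbf\Sigma^{\mathbf x}_k\big),$$ where $\mathbf C_k=\mathbf C_k(r_{k-1:k})$, $\mathbf D_k=\mathbf D_k(r_{k-1:k},\mathbf y_{k-1:k})$, and $\mathbf\Sigma_k^{\mathbf x}=\mathbf\Sigma_k^{\mathbf x}(r_{k-1:k})$ is positive definite. Then all the integrals that define the quantities below converge, and for all $k\ge1$, all values of $r_k$, and all $\mathbf y_0,\mathbf y_1,\dots$: 1. $\displaystyle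 p(r_k\mid\mathbf y_{0:k})\propto\sum_{r_{k-1}}p(r_k\mid r_{k-1})\,p(\mathbf y_k\mid\mathbf y_{k-1},r_{k-1:k})\,p(r_{k-1}\mid\mathbf y_{0:k-1})$, normalized by the sum over $r_k$; 2. $\displaystyle p(r_{k-1}\mid r_k,\mathbf y_{0:k})\propto p(r_k\mid r_{k-1})\,p(\mathbf y_k\mid\mathbf y_{k-1},r_{k-1:k})\,p(r_{k-1}\mid\mathbf y_{0:k-1})$, normalized by the sum over $r_{k-1}$; 3. $\displaystyle \mathrm E(\mathbf x_k\mid\mathbf y_{0:k},r_k)=\sum_{r_{k-1}}p(r_{k-1}\mid r_k,\mathbf y_{0:k})\big(\mathbf C_k\mu_{k-1}+\mathbf D_k\big)$; 4. $\displaystyle \mathrm E(\mathbf x_k\mathbf x_k^T\mid\mathbf y_{0:k},r_k)=\sum_{r_{k-1}}p(r_{k-1}\mid r_k,\mathbf y_{0:k})\big(\mathbf\Sigma^{\mathbf x}_k+\mathbf C_kM_{k-1}\mathbf C_k^T+\mathbf D_k\mu_{k-1}^T\mathbf C_k^T+\mathbf C_k\mu_{k-1}\mathbf D_k^T+\mathbf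 D_k\mathbf D_k^T\big)$, where $\mu_{k-1}=\mathrm E(\mathbf x_{k-1}\mid\mathbf y_{0:k-1},r_{k-1})$ and $M_{k-1}=\mathrm E(\mathbf x_{k-1}\mathbf x_{k-1}^T\mid\mathbf y_{0:k-1},r_{k-1})$. Moreover, for all $k\ge0$ and for $f(\mathbf x)=\mathbf x$ and $f(\mathbf x)=\mathbf x\mathbf x^T$, one has $\mathrm E(f(\mathbf x_k)\mid\mathbf y_{0:k})=\sum_{r_k}p(r_k\mid\mathbf y_{0:k})\,\mathrm E(f(\mathbf x_k)\mid\mathbf y_{0:k},r_k)$. Consequently the cost is linear in the number of observations: there are one fixed time-step program, made of arithmetic formulas, and a constant $c$, both depending only on $m$, $p$ and $K$, such that for every such model and every observation sequence, starting from the exact values at time $0$, executing the program once for each of the times $1,\dots,n$ yields the exact values of $p(r_n\mid\mathbf y_{0:n})$, $\mathrm E(\mathbf x_n\mid\mathbf y_{0:n},r_n)$, $\mathrm E(\mathbf x_n\mathbf x_n^T\mid\mathbf y_{0:n},r_n)$, $\mathrm E(\mathbf x_n\mid\mathbf y_{0:n})$ and $\mathrm E(\mathbf x_n\mathbf x_n^T\mid\mathbf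 y_{0:n})$ in at most $c\,n$ elementary steps. An elementary step is one exact real operation $+,-,\times,\div$, one use of a rational constant, or one access to a stored value or to a value at the current data of $p(r_k\mid r_{k-1})$, $p(\mathbf y_k\mid\mathbf y_{k-1},r_{k-1:k})$ or an entry of $\mathbf C_k$, $\mathbf D_k$, $\mathbf\Sigma_k^{\mathbf x}$. -/

import Mathlib

open MeasureTheory Matrix

noncomputable section

/-- The Gaussian probability density function `N(x; μ; P)` on `ℝ^ι` with mean `μ` and (positive
definite) covariance matrix `P`. -/
def gaussianDensity {ι : Type} [Fintype ι] [DecidableEq ι]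
    (μ : ι → ℝ) (P : Matrix ι ι ℝ) (x : ι → ℝ) : ℝ :=
  (Real.sqrt ((2 * Real.pi) ^ (Fintype.card ι) * P.det))⁻¹ *
    Real.exp (-((x - μ) ⬝ᵥ (P⁻¹ *ᵥ (x - μ))) / 2)

/-- A conditional linear and Gaussian pairwise Markov chain with jumps: hidden states in `ℝ^m`,
observations in `ℝ^p`, regimes in a set of `K` elements. All the parameters with a time index `k + 1`
describe the passage from time `k` to time `k + 1`; their first regime argument is `r_k`, the
second one is `r_{k+1}`. The parameters at time index `0` are not used. -/
structure CondGaussianPMC (m p K : ℕ) where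
  /-- `p(r_0)` -/
  initProb : Fin K → ℝ
  initProb_nonneg : ∀ i, 0 ≤ initProb i
  initProb_sum : ∑ i, initProb i = 1
  /-- `p(r_k | r_{k-1})`, as a function of `k`, `r_{k-1}`, `r_k` -/
  jumpProb : ℕ → Fin K → Fin K → ℝ
  jumpProb_nonneg : ∀ k i j, 0 ≤ jumpProb (k + 1) i j
  jumpProb_sum : ∀ k i, ∑ j, jumpProb (k + 1) i j = 1
  /-- the initial density `p(x_0, y_0 | r_0)`, as a function of `r_0`, `x_0`, `y_0` -/
  initDensity : Fin K → (Fin m → ℝ) → (Fin p → ℝ) → ℝ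
  initDensity_nonneg : ∀ i x y, 0 ≤ initDensity i x y
  initDensity_integral : ∀ i, ∫ z : (Fin m → ℝ) × (Fin p → ℝ), initDensity i z.1 z.2 = 1
  /-- the density of `y_0` given `r_0` is finite -/
  initDensity_integrable : ∀ i y, Integrable (fun x => initDensity i x y)
  /-- the second moments of `x_0` given `y_0` and `r_0` are finite -/
  initDensity_moment : ∀ i y a, Integrable (fun x => x a ^ 2 * initDensity i x y)
  F1 : ℕ → Fin K → Fin K → Matrix (Fin m) (Fin m) ℝ
  F2 : ℕ → Fin K → Fin K → Matrix (Fin m) (Fin p) ℝ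
  H1 : ℕ → Fin K → Fin K → Matrix (Fin p) (Fin m) ℝ
  H2 : ℕ → Fin K → Fin K → Matrix (Fin p) (Fin p) ℝ
  S11 : ℕ → Fin K → Fin K → Matrix (Fin m) (Fin m) ℝ
  S21 : ℕ → Fin K → Fin K → Matrix (Fin p) (Fin m) ℝ
  S22 : ℕ → Fin K → Fin K → Matrix (Fin p) (Fin p) ℝ
  posDef : ∀ k i j, (Matrix.fromBlocks (S11 (k + 1) i j) (S21 (k + 1) i j)ᵀ
    (S21 (k + 1) i j) (S22 (k + 1) i j)).PosDef

namespace CondGaussianPMC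

variable {m p K : ℕ} (M : CondGaussianPMC m p K)

/-- The transition density `p(x_k, y_k | x_{k-1}, y_{k-1}, r_{k-1} = i, r_k = j)`, at
`x_{k-1} = x'`, `y_{k-1} = y'`, `x_k = x`, `y_k = y`: the Gaussian density with mean
`B_k z_{k-1}` and covariance matrix `Σ_k`. -/
def trans (k : ℕ) (i j : Fin K) (x' : Fin m → ℝ) (y' : Fin p → ℝ)
    (x : Fin m → ℝ) (y : Fin p → ℝ) : ℝ :=
  gaussianDensity
    (Matrix.fromBlocks (M.F1 k i j) (M.F2 k i j) (M.H1 k i j) (M.H2 k i j) *ᵥ Sum.elim x' y')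
    (Matrix.fromBlocks (M.S11 k i j) (M.S21 k i j)ᵀ (M.S21 k i j) (M.S22 k i j))
    (Sum.elim x y)

/-- The conditional density `p(y_k | x_{k-1}, y_{k-1}, r_{k-1} = i, r_k = j)`. -/
def transY (k : ℕ) (i j : Fin K) (x' : Fin m → ℝ) (y' : Fin p → ℝ) (y : Fin p → ℝ) : ℝ :=
  ∫ x : Fin m → ℝ, M.trans k i j x' y' x y

/-- The conditional density `p(x_k | x_{k-1}, y_{k-1}, y_k, r_{k-1} = i, r_k = j)`. -/
def transX (k : ℕ) (i j : Fin K) (x' : Fin m → ℝ) (y' : Fin p → ℝ)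
    (x : Fin m → ℝ) (y : Fin p → ℝ) : ℝ :=
  M.trans k i j x' y' x y / M.transY k i j x' y' y

/-- The joint density `p(x_{0:k}, y_{0:k}, r_{0:k})`. -/
def joint (k : ℕ) (x : Fin (k + 1) → Fin m → ℝ) (y : Fin (k + 1) → Fin p → ℝ)
    (r : Fin (k + 1) → Fin K) : ℝ :=
  M.initProb (r 0) * (∏ l : Fin k, M.jumpProb (l + 1) (r l.castSucc) (r l.succ)) *
    M.initDensity (r 0) (x 0) (y 0) *
    ∏ l : Fin k, M.trans (l + 1) (r l.castSucc) (r l.succ)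
      (x l.castSucc) (y l.castSucc) (x l.succ) (y l.succ)

/-- The density `p(y_{0:k})`. -/
def obsDensity (k : ℕ) (y : Fin (k + 1) → Fin p → ℝ) : ℝ :=
  ∑ r : Fin (k + 1) → Fin K, ∫ x : Fin (k + 1) → Fin m → ℝ, M.joint k x y r

/-- The density `p(y_{0:k}, r_k = j)`. -/
def obsRegimeDensity (k : ℕ) (y : Fin (k + 1) → Fin p → ℝ) (j : Fin K) : ℝ :=
  ∑ r : Fin (k + 1) → Fin K with r (Fin.last k) = j,
    ∫ x : Fin (k + 1) → Fin m → ℝ, M.joint k x y r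

/-- The density `p(y_{0:k+1}, r_k = i, r_{k+1} = j)`. -/
def obsPairDensity (k : ℕ) (y : Fin (k + 2) → Fin p → ℝ) (i j : Fin K) : ℝ :=
  ∑ r : Fin (k + 2) → Fin K with r (Fin.last k).castSucc = i ∧ r (Fin.last (k + 1)) = j,
    ∫ x : Fin (k + 2) → Fin m → ℝ, M.joint (k + 1) x y r

/-- `p(r_k = j | y_{0:k})` -/
def regimeProb (k : ℕ) (y : Fin (k + 1) → Fin p → ℝ) (j : Fin K) : ℝ :=
  M.obsRegimeDensity k y j / M.obsDensity k y

/-- `p(r_k = i | r_{k+1} = j, y_{0:k+1})` -/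
def backProb (k : ℕ) (y : Fin (k + 2) → Fin p → ℝ) (i j : Fin K) : ℝ :=
  M.obsPairDensity k y i j / M.obsRegimeDensity (k + 1) y j

/-- `E(f(x_k) | y_{0:k}, r_k = j)` -/
def regimeExpect (k : ℕ) (y : Fin (k + 1) → Fin p → ℝ) (j : Fin K)
    (f : (Fin m → ℝ) → ℝ) : ℝ :=
  (∑ r : Fin (k + 1) → Fin K with r (Fin.last k) = j,
    ∫ x : Fin (k + 1) → Fin m → ℝ, f (x (Fin.last k)) * M.joint k x y r) /
    M.obsRegimeDensity k y j

/-- `E(f(x_k) | y_{0:k})` -/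
def obsExpect (k : ℕ) (y : Fin (k + 1) → Fin p → ℝ) (f : (Fin m → ℝ) → ℝ) : ℝ :=
  (∑ r : Fin (k + 1) → Fin K,
    ∫ x : Fin (k + 1) → Fin m → ℝ, f (x (Fin.last k)) * M.joint k x y r) /
    M.obsDensity k y

/-- `E(x_k | y_{0:k}, r_k = j)` -/
def regimeMean (k : ℕ) (y : Fin (k + 1) → Fin p → ℝ) (j : Fin K) : Fin m → ℝ :=
  fun a => M.regimeExpect k y j (fun x => x a)

/-- `E(x_k x_kᵀ | y_{0:k}, r_k = j)` -/
def regimeSecond (k : ℕ) (y : Fin (k + 1) → Fin p → ℝ) (j : Fin K) :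
    Matrix (Fin m) (Fin m) ℝ :=
  Matrix.of fun a b => M.regimeExpect k y j (fun x => x a * x b)

/-- `E(x_k | y_{0:k})` -/
def obsMean (k : ℕ) (y : Fin (k + 1) → Fin p → ℝ) : Fin m → ℝ :=
  fun a => M.obsExpect k y (fun x => x a)

/-- `E(x_k x_kᵀ | y_{0:k})` -/
def obsSecond (k : ℕ) (y : Fin (k + 1) → Fin p → ℝ) : Matrix (Fin m) (Fin m) ℝ :=
  Matrix.of fun a b => M.obsExpect k y (fun x => x a * x b)

/-- The two structural conditions on the model. Given `z_{k-1}` and `r_{k-1:k}`, the density of `y_k`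
depends on `y_{k-1}` only, and `g k r_{k-1} r_k y_{k-1} y_k` is its value
`p(y_k | y_{k-1}, r_{k-1:k})`; given `z_{k-1}`, `y_k` and `r_{k-1:k}`, the vector `x_k` is Gaussian with
mean `C_k x_{k-1} + D_k` and covariance matrix `Sx_k`. -/
structure ExactFiltering (g : ℕ → Fin K → Fin K → (Fin p → ℝ) → (Fin p → ℝ) → ℝ)
    (C : ℕ → Fin K → Fin K → Matrix (Fin m) (Fin m) ℝ)
    (D : ℕ → Fin K → Fin K → (Fin p → ℝ) → (Fin p → ℝ) → Fin m → ℝ)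
    (Sx : ℕ → Fin K → Fin K → Matrix (Fin m) (Fin m) ℝ) : Prop where
  transY_eq : ∀ k i j x' y' y, M.transY (k + 1) i j x' y' y = g (k + 1) i j y' y
  posDef_Sx : ∀ k i j, (Sx (k + 1) i j).PosDef
  transX_eq : ∀ k i j x' y' x y, M.transX (k + 1) i j x' y' x y =
    gaussianDensity (C (k + 1) i j *ᵥ x' + D (k + 1) i j y' y) (Sx (k + 1) i j) x

end CondGaussianPMC

/-- The first `k + 1` observations `y_{0:k}`. -/
def obs {p : ℕ} (y : ℕ → Fin p → ℝ) (k : ℕ) : Fin (k + 1) → Fin p → ℝ := fun l => y l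

/-! ### Arithmetic programs and their cost -/

/-- Arithmetic formulas in real-valued inputs indexed by `ι`. -/
inductive ArithFormula (ι : Type) : Type
  | input : ι → ArithFormula ι
  | const : ℚ → ArithFormula ι
  | add : ArithFormula ι → ArithFormula ι → ArithFormula ι
  | sub : ArithFormula ι → ArithFormula ι → ArithFormula ι
  | mul : ArithFormula ι → ArithFormula ι → ArithFormula ι
  | div : ArithFormula ι → ArithFormula ι → ArithFormula ι

namespace ArithFormula

/-- The value of a formula in exact real arithmetic. A quotient with denominator zero has the
value zero. -/
def eval {ι : Type} (v : ι → ℝ) : ArithFormula ι → ℝ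
  | input i => v i
  | const q => (q : ℝ)
  | add s t => s.eval v + t.eval v
  | sub s t => s.eval v - t.eval v
  | mul s t => s.eval v * t.eval v
  | div s t => s.eval v / t.eval v

/-- The number of elementary steps in the evaluation of a formula: each arithmetic operation, each
constant and each access to an input counts for one step. -/
def cost {ι : Type} : ArithFormula ι → ℕ
  | input _ => 1
  | const _ => 1
  | add s t => s.cost + t.cost + 1
  | sub s t => s.cost + t.cost + 1
  | mul s t => s.cost + t.cost + 1
  | div s t => s.cost + t.cost + 1

end ArithFormula

/-- What the filter stores at a given time `k`: values meant to be `p(r_k | y_{0:k})`,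
`E(x_k | y_{0:k}, r_k)`, `E(x_k x_kᵀ | y_{0:k}, r_k)`, `E(x_k | y_{0:k})`, `E(x_k x_kᵀ | y_{0:k})`. -/
@[ext] structure FilterState (m K : ℕ) where
  prob : Fin K → ℝ
  mean : Fin K → Fin m → ℝ
  second : Fin K → Matrix (Fin m) (Fin m) ℝ
  phiMean : Fin m → ℝ
  phiSecond : Matrix (Fin m) (Fin m) ℝ

/-- The real numbers that the filter can read at time `k`: entries of its stored values of time `k - 1`,
and the values at the current data of `p(r_k | r_{k-1})`, `p(y_k | y_{k-1}, r_{k-1:k})`, and of the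
entries of `C_k`, `D_k` and of the covariance matrix `Sx_k`. -/
inductive FilterInput (m K : ℕ) : Type
  | prob : Fin K → FilterInput m K
  | mean : Fin K → Fin m → FilterInput m K
  | second : Fin K → Fin m → Fin m → FilterInput m K
  | jump : Fin K → Fin K → FilterInput m K
  | lik : Fin K → Fin K → FilterInput m K
  | matC : Fin K → Fin K → Fin m → Fin m → FilterInput m K
  | vecD : Fin K → Fin K → Fin m → FilterInput m K
  | matSx : Fin K → Fin K → Fin m → Fin m → FilterInput m K

/-- One time step of a filtering algorithm: a formula for each number to be stored. -/
structure FilterProgram (m K : ℕ) where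
  prob : Fin K → ArithFormula (FilterInput m K)
  mean : Fin K → Fin m → ArithFormula (FilterInput m K)
  second : Fin K → Fin m → Fin m → ArithFormula (FilterInput m K)
  phiMean : Fin m → ArithFormula (FilterInput m K)
  phiSecond : Fin m → Fin m → ArithFormula (FilterInput m K)

namespace FilterProgram

variable {m K : ℕ}

/-- The number of elementary steps in one execution of the program. -/
def cost (P : FilterProgram m K) : ℕ :=
  (∑ j, (P.prob j).cost) + (∑ j, ∑ a, (P.mean j a).cost) +
    (∑ j, ∑ a, ∑ b, (P.second j a b).cost) +
    (∑ a, (P.phiMean a).cost) + ∑ a, ∑ b, (P.phiSecond a b).cost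

/-- One execution of the program. -/
def exec (P : FilterProgram m K) (v : FilterInput m K → ℝ) : FilterState m K where
  prob j := (P.prob j).eval v
  mean j a := (P.mean j a).eval v
  second j := Matrix.of fun a b => (P.second j a b).eval v
  phiMean a := (P.phiMean a).eval v
  phiSecond := Matrix.of fun a b => (P.phiSecond a b).eval v

/-- Start from the stored values `s₀` at time `0` and execute the program once for each of the times
`1, …, n`, the inputs at time `k` being `v k s` if `s` is what was stored at time `k - 1`. The
result is what is stored at time `n`, together with the total number of elementary steps. -/
def run (P : FilterProgram m K) (v : ℕ → FilterState m K → FilterInput m K → ℝ)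
    (s₀ : FilterState m K) : ℕ → FilterState m K × ℕ
  | 0 => (s₀, 0)
  | n + 1 =>
    let s := P.run v s₀ n
    (P.exec (v (n + 1) s.1), s.2 + P.cost)

end FilterProgram

namespace CondGaussianPMC

variable {m p K : ℕ} (M : CondGaussianPMC m p K)

/-- The inputs that the model and the observations `y` provide at time `k ≥ 1` if `s` is what was
stored at time `k - 1`. -/
def filterInput (g : ℕ → Fin K → Fin K → (Fin p → ℝ) → (Fin p → ℝ) → ℝ)
    (C : ℕ → Fin K → Fin K → Matrix (Fin m) (Fin m) ℝ)
    (D : ℕ → Fin K → Fin K → (Fin p → ℝ) → (Fin p → ℝ) → Fin m → ℝ)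
    (Sx : ℕ → Fin K → Fin K → Matrix (Fin m) (Fin m) ℝ)
    (y : ℕ → Fin p → ℝ) (k : ℕ) (s : FilterState m K) : FilterInput m K → ℝ
  | .prob i => s.prob i
  | .mean i a => s.mean i a
  | .second i a b => s.second i a b
  | .jump i j => M.jumpProb k i j
  | .lik i j => g k i j (y (k - 1)) (y k)
  | .matC i j a b => C k i j a b
  | .vecD i j a => D k i j (y (k - 1)) (y k) a
  | .matSx i j a b => Sx k i j a b

/-- The exact values `p(r_k | y_{0:k})`, `E(x_k | y_{0:k}, r_k)`, `E(x_k x_kᵀ | y_{0:k}, r_k)`,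
`E(x_k | y_{0:k})` and `E(x_k x_kᵀ | y_{0:k})`. -/
def exactState (y : ℕ → Fin p → ℝ) (k : ℕ) : FilterState m K where
  prob := M.regimeProb k (obs y k)
  mean := M.regimeMean k (obs y k)
  second := M.regimeSecond k (obs y k)
  phiMean := M.obsMean k (obs y k)
  phiSecond := M.obsSecond k (obs y k)

end CondGaussianPMC

end

/-! The structural hypotheses split the transition density into the scalar `g`, free of the hidden
states, times a Gaussian density in the new state whose mean is affine in the old one
(`ExactFiltering.trans_eq`). Fix a regime path and integrate the new state out first. The functions
1, x and x xᵀ of the new state become 1, Cx' + D and Sx + (Cx' + D)(Cx' + D)ᵀ of the old state x'.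
So the mass and the first two moments of the joint density at time k + 1 are `pairWeight` times
combinations of the same moments at time k, with coefficients that depend on the path only through
its last two regimes (`integral_joint_succ`, `integral_coord_joint_succ`,
`integral_coord_coord_joint_succ`). The same induction gives convergence (`finiteMoments_joint`).

Hence the exponentially many regime paths need not be enumerated: with the last two regimes fixed,
the sum over paths collapses to a sum over paths ending in one given regime (`sum_path_pair_init`).
Finitely many unnormalized moments per regime thus form a closed recursion, and quotients give the
stated formulas. Vanishing denominators do no harm, since the joint density is nonnegative: zero
mass forces zero moments (`rawExpect_eq`).

The recursion is one arithmetic expression of size determined by m and K, whence the linear cost. -/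

section GaussianMoments

open ProbabilityTheory

/-! ### Moments of the standard Gaussian on the line -/

theorem integrable_pow_mul_gaussianPDFReal (n : ℕ) :
    Integrable (fun u : ℝ => u ^ n * gaussianPDFReal 0 1 u) := by
  have h : Integrable (fun u : ℝ => u ^ n) (gaussianReal 0 1) := by
    have h1 := (memLp_id_gaussianReal (μ := 0) (v := 1) (n : NNReal)).integrable_norm_pow'
    refine h1.mono' (by fun_prop) (ae_of_all _ fun x => ?_)
    simp
  rw [gaussianReal_of_var_ne_zero _ one_ne_zero,
    integrable_withDensity_iff (by fun_prop) (ae_of_all _ fun x => gaussianPDF_lt_top)] at h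
  simpa [toReal_gaussianPDF] using h

theorem integral_mul_gaussianPDFReal :
    ∫ u : ℝ, u * gaussianPDFReal 0 1 u = 0 := by
  have h := integral_id_gaussianReal (μ := 0) (v := 1)
  rw [integral_gaussianReal_eq_integral_smul one_ne_zero] at h
  simpa [mul_comm] using h

theorem integral_sq_mul_gaussianPDFReal :
    ∫ u : ℝ, u ^ 2 * gaussianPDFReal 0 1 u = 1 := by
  have h := variance_id_gaussianReal (μ := 0) (v := 1)
  rw [variance_eq_integral (by fun_prop)] at h
  simp only [id, integral_id_gaussianReal] at h
  rw [integral_gaussianReal_eq_integral_smul one_ne_zero] at h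
  simpa [mul_comm] using h

/-- Writing a coordinate as a product over all coordinates lets moments of a product density factor
into one-dimensional integrals. -/
theorem prod_pow_ite {ι : Type} [Fintype ι] [DecidableEq ι] (u : ι → ℝ) (i : ι) :
    ∏ k, u k ^ (if k = i then 1 else 0) = u i := by
  rw [Finset.prod_eq_single i] <;> simp +contextual

/-- The density of the standard Gaussian distribution on `ℝ^ι`, written as a product. -/
noncomputable def stdGaussianDensity {ι : Type} [Fintype ι] (u : ι → ℝ) : ℝ :=
  ∏ i, gaussianPDFReal 0 1 (u i)

theorem stdGaussianDensity_eq {ι : Type} [Fintype ι] (u : ι → ℝ) :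
    stdGaussianDensity u =
      (Real.sqrt (2 * Real.pi) ^ (Fintype.card ι))⁻¹ * Real.exp (-(u ⬝ᵥ u) / 2) := by
  simp only [stdGaussianDensity, gaussianPDFReal]
  rw [Finset.prod_mul_distrib, ← Real.exp_sum]
  congr 1
  · rw [Finset.prod_const, Finset.card_univ, NNReal.coe_one, mul_one, inv_pow]
  · congr 1
    simp only [dotProduct, sub_zero, NNReal.coe_one, mul_one, neg_div, Finset.sum_neg_distrib,
      Finset.sum_div, sq]

/-- The weight `s` is distributed so that each summand is a constant times an integrand controlled
by `FiniteMoments`. -/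
theorem affine_mul_eq {ι : Type} [Fintype ι] (A : Matrix ι ι ℝ) (μ u : ι → ℝ) (a : ι) (s : ℝ) :
    (μ + A *ᵥ u) a * s = μ a * s + ∑ i, A a i * (u i * s) := by
  simp only [Pi.add_apply, mulVec, dotProduct, add_mul, Finset.sum_mul, mul_assoc]

theorem affine_mul_affine_mul_eq {ι : Type} [Fintype ι] (A : Matrix ι ι ℝ) (μ u : ι → ℝ) (a b : ι) (s : ℝ) :
    (μ + A *ᵥ u) a * (μ + A *ᵥ u) b * s =
      μ a * μ b * s + ∑ i, μ b * A a i * (u i * s) + ∑ i, μ a * A b i * (u i * s) +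
        ∑ i, ∑ j, A a i * A b j * (u i * u j * s) := by
  have h1 : ∑ i, ∑ j, A a i * A b j * (u i * u j * s) =
      (∑ i, A a i * u i) * (∑ j, A b j * u j) * s := by
    rw [Finset.sum_mul_sum]
    simp only [Finset.sum_mul]
    exact Finset.sum_congr rfl fun i _ => Finset.sum_congr rfl fun j _ => by ring
  have h2 : ∀ c d, ∑ i, μ c * A d i * (u i * s) = μ c * (∑ i, A d i * u i) * s := by
    intro c d
    rw [Finset.mul_sum, Finset.sum_mul]
    exact Finset.sum_congr rfl fun i _ => by ring
  rw [h1, h2, h2]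
  simp only [Pi.add_apply, mulVec, dotProduct]
  ring

/-- The measure with density `w` with respect to `ν` has finite mass, and the coordinates of `q` have
finite first and second moments for it. -/
structure FiniteMoments {α : Type} [MeasurableSpace α] (ν : Measure α) {ι : Type}
    (q : α → ι → ℝ) (w : α → ℝ) : Prop where
  mass : Integrable w ν
  first : ∀ a, Integrable (fun e => q e a * w e) ν
  second : ∀ a b, Integrable (fun e => q e a * q e b * w e) ν

/-! ### Moments of a weight and of affine images of its coordinates -/

namespace FiniteMoments

variable {α : Type} [MeasurableSpace α] {ν : Measure α} {ι : Type} {q : α → ι → ℝ} {w : α → ℝ}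

/-- |t| ≤ 1 + t² and |st| ≤ s² + t². Only nonnegative test functions remain to be checked, which is
the form that Tonelli's theorem handles. -/
theorem of_sq (hq : Measurable q) (h0 : Integrable w ν)
    (h2 : ∀ a, Integrable (fun e => q e a ^ 2 * w e) ν) : FiniteMoments ν q w where
  mass := h0
  first a := by
    refine (h0.norm.add (h2 a).norm).mono' ?_ (ae_of_all _ fun e => ?_)
    · exact ((measurable_pi_apply a).comp hq).aestronglyMeasurable.mul h0.aestronglyMeasurable
    · simp only [Pi.add_apply, norm_mul, Real.norm_eq_abs, abs_pow]
      nlinarith [abs_nonneg (w e), mul_nonneg (abs_nonneg (w e)) (sq_nonneg (|q e a| - 1)),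
        mul_nonneg (abs_nonneg (w e)) (sq_nonneg |q e a|)]
  second a b := by
    refine ((h2 a).norm.add (h2 b).norm).mono' ?_ (ae_of_all _ fun e => ?_)
    · exact (((measurable_pi_apply a).comp hq).mul
        ((measurable_pi_apply b).comp hq)).aestronglyMeasurable.mul h0.aestronglyMeasurable
    · simp only [Pi.add_apply, norm_mul, Real.norm_eq_abs, abs_pow]
      nlinarith [abs_nonneg (w e), mul_nonneg (abs_nonneg (w e)) (sq_nonneg (|q e a| - |q e b|)),
        mul_nonneg (abs_nonneg (w e)) (sq_nonneg |q e a|),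
        mul_nonneg (abs_nonneg (w e)) (sq_nonneg |q e b|)]

theorem const_mul (h : FiniteMoments ν q w) (c : ℝ) : FiniteMoments ν q fun e => c * w e where
  mass := h.mass.const_mul c
  first a := by simpa only [mul_left_comm] using (h.first a).const_mul c
  second a b := by simpa only [mul_left_comm] using (h.second a b).const_mul c

theorem comp_measurePreserving {β : Type} [MeasurableSpace β] {ρ : Measure β} {f : β → α}
    (hf : MeasurePreserving f ρ ν) (h : FiniteMoments ν q w) :
    FiniteMoments ρ (fun b => q (f b)) fun b => w (f b) where
  mass := hf.integrable_comp_of_integrable h.mass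
  first a := hf.integrable_comp_of_integrable (h.first a)
  second a b := hf.integrable_comp_of_integrable (h.second a b)

/-- If `w ≥ 0` has total mass zero, then all its moments vanish. -/
theorem integral_mul_eq_zero (h : FiniteMoments ν q w) (hw : ∀ e, 0 ≤ w e)
    (h0 : ∫ e, w e ∂ν = 0) (F : α → ℝ) : ∫ e, F e * w e ∂ν = 0 := by
  have h1 : w =ᵐ[ν] 0 := (integral_eq_zero_iff_of_nonneg hw h.mass).mp h0
  refine integral_eq_zero_of_ae ?_
  filter_upwards [h1] with e he
  simp [he]

section Affine

variable [Fintype ι]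

theorem integrable_affine (h : FiniteMoments ν q w) (A : Matrix ι ι ℝ)
    (μ : ι → ℝ) (a : ι) : Integrable (fun e => (μ + A *ᵥ q e) a * w e) ν := by
  simp_rw [affine_mul_eq]
  exact (h.mass.const_mul _).add (integrable_finsetSum _ fun i _ => (h.first i).const_mul _)

theorem integral_affine (h : FiniteMoments ν q w) (A : Matrix ι ι ℝ)
    (μ : ι → ℝ) (a : ι) :
    ∫ e, (μ + A *ᵥ q e) a * w e ∂ν =
      μ a * ∫ e, w e ∂ν + ∑ i, A a i * ∫ e, q e i * w e ∂ν := by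
  simp_rw [affine_mul_eq]
  have hi : ∀ i, Integrable (fun e => A a i * (q e i * w e)) ν :=
    fun i => (h.first i).const_mul _
  rw [integral_add (h.mass.const_mul _) (integrable_finsetSum _ fun i _ => hi i),
    integral_finsetSum _ fun i _ => hi i]
  simp_rw [integral_const_mul]

theorem integrable_affine_mul_affine (h : FiniteMoments ν q w) (A : Matrix ι ι ℝ)
    (μ : ι → ℝ) (a b : ι) :
    Integrable (fun e => (μ + A *ᵥ q e) a * (μ + A *ᵥ q e) b * w e) ν := by
  simp_rw [affine_mul_affine_mul_eq]
  exact (((h.mass.const_mul _).add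
    (integrable_finsetSum _ fun i _ => (h.first i).const_mul _)).add
    (integrable_finsetSum _ fun i _ => (h.first i).const_mul _)).add
    (integrable_finsetSum _ fun i _ => integrable_finsetSum _ fun j _ =>
      (h.second i j).const_mul _)

theorem integral_affine_mul_affine (h : FiniteMoments ν q w) (A : Matrix ι ι ℝ)
    (μ : ι → ℝ) (a b : ι) :
    ∫ e, (μ + A *ᵥ q e) a * (μ + A *ᵥ q e) b * w e ∂ν =
      μ a * μ b * ∫ e, w e ∂ν + ∑ i, μ b * A a i * ∫ e, q e i * w e ∂ν +
        ∑ i, μ a * A b i * ∫ e, q e i * w e ∂ν +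
        ∑ i, ∑ j, A a i * A b j * ∫ e, q e i * q e j * w e ∂ν := by
  simp_rw [affine_mul_affine_mul_eq]
  have h0 : Integrable (fun e => μ a * μ b * w e) ν := h.mass.const_mul _
  have hi := fun (c : ℝ) (i : ι) => (h.first i).const_mul c
  have hij : ∀ i j, Integrable (fun e => A a i * A b j * (q e i * q e j * w e)) ν := fun i j =>
    (h.second i j).const_mul _
  have hs : ∀ c : ι → ℝ, Integrable (fun e => ∑ i, c i * (q e i * w e)) ν :=
    fun c => integrable_finsetSum _ fun i _ => hi (c i) i
  have hss : ∀ i, Integrable (fun e => ∑ j, A a i * A b j * (q e i * q e j * w e)) ν :=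
    fun i => integrable_finsetSum _ fun j _ => hij i j
  have h1 : Integrable (fun e => μ a * μ b * w e +
      ∑ i, μ b * A a i * (q e i * w e)) ν := h0.add (hs fun i => μ b * A a i)
  have h2 : Integrable (fun e => μ a * μ b * w e +
      ∑ i, μ b * A a i * (q e i * w e) + ∑ i, μ a * A b i * (q e i * w e)) ν :=
    h1.add (hs fun i => μ a * A b i)
  rw [integral_add h2 (integrable_finsetSum _ fun i _ => hss i),
    integral_add h1 (hs fun i => μ a * A b i), integral_add h0 (hs fun i => μ b * A a i),
    integral_finsetSum _ fun i _ => hi _ i, integral_finsetSum _ fun i _ => hi _ i,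
    integral_finsetSum _ fun i _ => hss i]
  simp_rw [integral_finsetSum _ fun j _ => hij _ j, integral_const_mul]

end Affine

end FiniteMoments

/-! ### Moments of the standard Gaussian on a finite product -/

section Std

variable {ι : Type} [Fintype ι]

theorem integrable_stdGaussianDensity :
    Integrable (stdGaussianDensity : (ι → ℝ) → ℝ) := by
  exact Integrable.fintype_prod fun _ => integrable_gaussianPDFReal 0 1

theorem integral_stdGaussianDensity :
    ∫ u : ι → ℝ, stdGaussianDensity u = 1 := by
  unfold stdGaussianDensity
  rw [integral_fintype_prod_volume_eq_prod (fun _ : ι => gaussianPDFReal 0 1)]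
  simp [integral_gaussianPDFReal_eq_one]

variable [DecidableEq ι]

theorem coord_mul_stdGaussianDensity (i : ι) (u : ι → ℝ) :
    u i * stdGaussianDensity u =
      ∏ k, (u k ^ (if k = i then 1 else 0) * gaussianPDFReal 0 1 (u k)) := by
  rw [Finset.prod_mul_distrib, prod_pow_ite, stdGaussianDensity]

/-- Adding the two indicator exponents treats the diagonal case, with exponent 2, together with the
off-diagonal one. -/
theorem coord_mul_coord_mul_stdGaussianDensity (i j : ι) (u : ι → ℝ) :
    u i * u j * stdGaussianDensity u =
      ∏ k, (u k ^ ((if k = i then 1 else 0) + if k = j then 1 else 0) *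
        gaussianPDFReal 0 1 (u k)) := by
  simp_rw [pow_add]
  rw [Finset.prod_mul_distrib, Finset.prod_mul_distrib, prod_pow_ite, prod_pow_ite,
    stdGaussianDensity]

theorem integrable_coord_mul_stdGaussianDensity (i : ι) :
    Integrable (fun u : ι → ℝ => u i * stdGaussianDensity u) := by
  simp_rw [coord_mul_stdGaussianDensity]
  exact Integrable.fintype_prod (f := fun k u => u ^ (if k = i then 1 else 0) *
    gaussianPDFReal 0 1 u) fun k => integrable_pow_mul_gaussianPDFReal _

theorem integrable_coord_mul_coord_mul_stdGaussianDensity (i j : ι) :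
    Integrable (fun u : ι → ℝ => u i * u j * stdGaussianDensity u) := by
  simp_rw [coord_mul_coord_mul_stdGaussianDensity]
  exact Integrable.fintype_prod (f := fun k u =>
    u ^ ((if k = i then 1 else 0) + if k = j then 1 else 0) *
    gaussianPDFReal 0 1 u) fun k => integrable_pow_mul_gaussianPDFReal _

theorem integral_coord_mul_stdGaussianDensity (i : ι) :
    ∫ u : ι → ℝ, u i * stdGaussianDensity u = 0 := by
  simp_rw [coord_mul_stdGaussianDensity]
  rw [integral_fintype_prod_volume_eq_prod (fun k u => u ^ (if k = i then 1 else 0) *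
    gaussianPDFReal 0 1 u)]
  exact Finset.prod_eq_zero (Finset.mem_univ i) (by simp [integral_mul_gaussianPDFReal])

theorem integral_coord_mul_coord_mul_stdGaussianDensity (i j : ι) :
    ∫ u : ι → ℝ, u i * u j * stdGaussianDensity u = if i = j then 1 else 0 := by
  simp_rw [coord_mul_coord_mul_stdGaussianDensity]
  rw [integral_fintype_prod_volume_eq_prod (fun k u =>
    u ^ ((if k = i then 1 else 0) + if k = j then 1 else 0) * gaussianPDFReal 0 1 u)]
  split_ifs with h
  · subst h
    refine Finset.prod_eq_one fun k _ => ?_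
    by_cases hk : k = i
    · simp [hk, integral_sq_mul_gaussianPDFReal]
    · simp [hk, integral_gaussianPDFReal_eq_one]
  · exact Finset.prod_eq_zero (Finset.mem_univ i) (by simp [h, integral_mul_gaussianPDFReal])

end Std

/-! ### Reduction of a general Gaussian to the standard one by an affine map -/

section ChangeOfVariables

variable {ι : Type} [Fintype ι] [DecidableEq ι]

theorem map_affine_volume {A : Matrix ι ι ℝ} (hA : A.det ≠ 0) (μ : ι → ℝ) :
    Measure.map (fun u : ι → ℝ => μ + A *ᵥ u) volume =
      ENNReal.ofReal |A.det⁻¹| • (volume : Measure (ι → ℝ)) := by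
  have h := Real.map_matrix_volume_pi_eq_smul_volume_pi hA
  have hm : Measurable (Matrix.toLin' A) :=
    (LinearMap.continuous_of_finiteDimensional _).measurable
  have h2 : (fun u : ι → ℝ => μ + A *ᵥ u) = (fun x => μ + x) ∘ (Matrix.toLin' A) := by
    ext u; simp
  rw [h2, ← Measure.map_map (measurable_const_add μ) hm, h, Measure.map_smul,
    map_add_left_eq_self]

theorem measurableEmbedding_affine {A : Matrix ι ι ℝ} (hA : A.det ≠ 0) (μ : ι → ℝ) :
    MeasurableEmbedding (fun u : ι → ℝ => μ + A *ᵥ u) := by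
  have hu : IsUnit A.det := isUnit_iff_ne_zero.mpr hA
  refine Measurable.measurableEmbedding (by fun_prop) fun u v h => ?_
  have h1 : A *ᵥ u = A *ᵥ v := add_left_cancel h
  have h2 := congrArg (fun x => A⁻¹ *ᵥ x) h1
  simpa [mulVec_mulVec, Matrix.nonsing_inv_mul _ hu] using h2

theorem integrable_of_comp_affine {A : Matrix ι ι ℝ} (hA : A.det ≠ 0) (μ : ι → ℝ)
    {F : (ι → ℝ) → ℝ} (h : Integrable fun u => F (μ + A *ᵥ u)) : Integrable F := by
  have h1 := ((measurableEmbedding_affine hA μ).integrable_map_iff (g := F)).mpr h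
  rw [map_affine_volume hA] at h1
  rwa [integrable_smul_measure (by simpa using hA) (by simp)] at h1

theorem integral_eq_integral_comp_affine {A : Matrix ι ι ℝ} (hA : A.det ≠ 0) (μ : ι → ℝ)
    (F : (ι → ℝ) → ℝ) : ∫ x, F x = ∫ u, F (μ + A *ᵥ u) * |A.det| := by
  have h1 := (measurableEmbedding_affine hA μ).integral_map (μ := volume) F
  rw [map_affine_volume hA, integral_smul_measure, ENNReal.toReal_ofReal (abs_nonneg _)] at h1
  rw [integral_mul_const, ← h1, smul_eq_mul, mul_right_comm, ← abs_mul, inv_mul_cancel₀ hA]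
  simp

/-- The quadratic form (Au)ᵀ(AAᵀ)⁻¹(Au) collapses to uᵀu, and √det(AAᵀ) = |det A| cancels the
Jacobian. -/
theorem gaussianDensity_comp_affine {A : Matrix ι ι ℝ} (hA : A.det ≠ 0) (μ u : ι → ℝ) :
    gaussianDensity μ (A * Aᵀ) (μ + A *ᵥ u) * |A.det| = stdGaussianDensity u := by
  have hu : IsUnit A.det := isUnit_iff_ne_zero.mpr hA
  have hu' : IsUnit Aᵀ.det := by rwa [det_transpose]
  have h1 : (A *ᵥ u) ⬝ᵥ ((A * Aᵀ)⁻¹ *ᵥ (A *ᵥ u)) = u ⬝ᵥ u := by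
    rw [Matrix.mul_inv_rev, mulVec_mulVec, mul_assoc, Matrix.nonsing_inv_mul _ hu, mul_one,
      dotProduct_mulVec, ← vecMul_transpose, vecMul_vecMul, Matrix.mul_nonsing_inv _ hu',
      vecMul_one]
  have h2 : Real.sqrt ((2 * Real.pi) ^ Fintype.card ι * (A * Aᵀ).det) =
      Real.sqrt (2 * Real.pi) ^ Fintype.card ι * |A.det| := by
    rw [det_mul, det_transpose, Real.sqrt_mul (by positivity), Real.sqrt_mul_self_eq_abs]
    congr 1
    rw [Real.sqrt_eq_iff_mul_self_eq (by positivity) (by positivity), ← mul_pow,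
      Real.mul_self_sqrt (by positivity)]
  rw [stdGaussianDensity_eq, gaussianDensity, add_sub_cancel_left, h1, h2]
  have : |A.det| ≠ 0 := abs_ne_zero.mpr hA
  field_simp

end ChangeOfVariables

open scoped MatrixOrder in
theorem exists_mul_transpose_of_posDef {ι : Type} [Fintype ι] [DecidableEq ι]
    {P : Matrix ι ι ℝ} (hP : P.PosDef) : ∃ A : Matrix ι ι ℝ, A.det ≠ 0 ∧ P = A * Aᵀ := by
  obtain ⟨B, hB⟩ := CStarAlgebra.nonneg_iff_eq_star_mul_self.mp hP.posSemidef.nonneg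
  -- The positive square factorization has the form BᵀB, so the wanted factor is A = Bᵀ.
  have hB' : P = Bᵀ * Bᵀᵀ := by rw [hB, transpose_transpose]; rfl
  refine ⟨Bᵀ, fun h => hP.det_pos.ne' ?_, hB'⟩
  rw [hB', det_mul, h, zero_mul]

/-! ### Mass, mean and second moments of a general Gaussian -/

section Moments

variable {ι : Type} [Fintype ι] [DecidableEq ι] {P : Matrix ι ι ℝ}

theorem finiteMoments_stdGaussianDensity :
    FiniteMoments volume (fun u : ι → ℝ => u) stdGaussianDensity where
  mass := integrable_stdGaussianDensity
  first := integrable_coord_mul_stdGaussianDensity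
  second := integrable_coord_mul_coord_mul_stdGaussianDensity

theorem finiteMoments_gaussianDensity (hP : P.PosDef) (μ : ι → ℝ) :
    FiniteMoments volume (fun x : ι → ℝ => x) (gaussianDensity μ P) := by
  obtain ⟨A, hA, rfl⟩ := exists_mul_transpose_of_posDef hP
  have h0 : |A.det| ≠ 0 := abs_ne_zero.mpr hA
  -- The nonzero constant |det A| is inserted so that the pulled-back density becomes the standard
  -- one.
  refine ⟨?_, fun a => ?_, fun a b => ?_⟩ <;> refine integrable_of_comp_affine hA μ ?_ <;>
    rw [← integrable_mul_const_iff (isUnit_iff_ne_zero.mpr h0)] <;>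
    simp only [mul_assoc _ _ |A.det|, gaussianDensity_comp_affine hA]
  · exact integrable_stdGaussianDensity
  · exact finiteMoments_stdGaussianDensity.integrable_affine A μ a
  · exact finiteMoments_stdGaussianDensity.integrable_affine_mul_affine A μ a b

theorem integral_gaussianDensity (hP : P.PosDef) (μ : ι → ℝ) :
    ∫ x, gaussianDensity μ P x = 1 := by
  obtain ⟨A, hA, rfl⟩ := exists_mul_transpose_of_posDef hP
  rw [integral_eq_integral_comp_affine hA μ]
  simp_rw [gaussianDensity_comp_affine hA]
  exact integral_stdGaussianDensity

theorem integral_coord_mul_gaussianDensity (hP : P.PosDef) (μ : ι → ℝ) (a : ι) :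
    ∫ x, x a * gaussianDensity μ P x = μ a := by
  obtain ⟨A, hA, rfl⟩ := exists_mul_transpose_of_posDef hP
  rw [integral_eq_integral_comp_affine hA μ]
  simp_rw [mul_assoc _ _ |A.det|, gaussianDensity_comp_affine hA]
  rw [finiteMoments_stdGaussianDensity.integral_affine]
  simp [integral_stdGaussianDensity, integral_coord_mul_stdGaussianDensity]

/-- The linear terms vanish and the standard second moments are Kronecker deltas, so the double sum
leaves (AAᵀ)ₐᵦ = Pₐᵦ. -/
theorem integral_coord_mul_coord_mul_gaussianDensity (hP : P.PosDef) (μ : ι → ℝ) (a b : ι) :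
    ∫ x, x a * x b * gaussianDensity μ P x = P a b + μ a * μ b := by
  obtain ⟨A, hA, rfl⟩ := exists_mul_transpose_of_posDef hP
  rw [integral_eq_integral_comp_affine hA μ]
  simp_rw [mul_assoc _ _ |A.det|, gaussianDensity_comp_affine hA]
  rw [finiteMoments_stdGaussianDensity.integral_affine_mul_affine]
  simp [integral_stdGaussianDensity, integral_coord_mul_stdGaussianDensity,
    integral_coord_mul_coord_mul_stdGaussianDensity, Matrix.mul_apply, add_comm]

end Moments

theorem gaussianDensity_pos {ι : Type} [Fintype ι] [DecidableEq ι] {P : Matrix ι ι ℝ}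
    (hP : P.PosDef) (μ x : ι → ℝ) : 0 < gaussianDensity μ P x := by
  have := hP.det_pos
  unfold gaussianDensity
  positivity

theorem gaussianDensity_nonneg {ι : Type} [Fintype ι] [DecidableEq ι] (P : Matrix ι ι ℝ)
    (μ x : ι → ℝ) : 0 ≤ gaussianDensity μ P x := by
  unfold gaussianDensity
  positivity

end GaussianMoments

/-! ### Adjoining a Gaussian vector with affine conditional mean -/

section GaussianStep

variable {α : Type} [MeasurableSpace α] {ν : Measure α} {ι : Type} [Fintype ι] [DecidableEq ι]
  {q : α → ι → ℝ} {w : α → ℝ} {S : Matrix ι ι ℝ}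

/-- The joint weight of a point `e` of weight `w e` and of a Gaussian vector whose mean is the affine
function `μ + A q(e)` and whose covariance matrix is `S`. -/
noncomputable def gaussianStep (q : α → ι → ℝ) (w : α → ℝ) (A : Matrix ι ι ℝ) (μ : ι → ℝ)
    (S : Matrix ι ι ℝ) (z : (ι → ℝ) × α) : ℝ :=
  w z.2 * gaussianDensity (μ + A *ᵥ q z.2) S z.1

theorem measurable_gaussianDensity_affine (hq : Measurable q) (A : Matrix ι ι ℝ) (μ : ι → ℝ)
    (S : Matrix ι ι ℝ) :
    Measurable fun z : (ι → ℝ) × α => gaussianDensity (μ + A *ᵥ q z.2) S z.1 := by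
  unfold gaussianDensity
  have h1 : Measurable fun z : (ι → ℝ) × α => z.1 - (μ + A *ᵥ q z.2) := by
    have : Measurable fun z : (ι → ℝ) × α => A *ᵥ q z.2 :=
      (Continuous.matrix_mulVec continuous_const continuous_id).measurable.comp
        (hq.comp measurable_snd)
    exact measurable_fst.sub (this.const_add μ)
  have h2 : Continuous fun t : ι → ℝ => t ⬝ᵥ (S⁻¹ *ᵥ t) :=
    continuous_id.dotProduct (Continuous.matrix_mulVec continuous_const continuous_id)
  exact (((h2.measurable.comp h1).neg.div_const 2).exp).const_mul _

theorem aestronglyMeasurable_mul_gaussianStep [SFinite ν] (hq : Measurable q)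
    (hw : AEStronglyMeasurable w ν) (A : Matrix ι ι ℝ) (μ : ι → ℝ) (S : Matrix ι ι ℝ)
    {F : (ι → ℝ) → ℝ} (hF : Measurable F) :
    AEStronglyMeasurable (fun z => F z.1 * gaussianStep q w A μ S z)
      ((volume : Measure (ι → ℝ)).prod ν) :=
  (hF.comp measurable_fst).aestronglyMeasurable.mul
    (hw.comp_snd.mul (measurable_gaussianDensity_affine hq A μ S).aestronglyMeasurable)

/-- Tonelli: `G t` is the expectation of `F` under the Gaussian with mean `t`, so integrating the
Gaussian variable first leaves `G` at the conditional mean. Nonnegativity of `F` identifies the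
integral of the norm. -/
theorem integrable_mul_gaussianStep [SFinite ν] (hq : Measurable q)
    (hw : AEStronglyMeasurable w ν) (A : Matrix ι ι ℝ) (μ : ι → ℝ)
    {F G : (ι → ℝ) → ℝ} (hF : Measurable F) (hF0 : ∀ x, 0 ≤ F x)
    (hFi : ∀ t, Integrable fun x => F x * gaussianDensity t S x)
    (hFG : ∀ t, ∫ x, F x * gaussianDensity t S x = G t)
    (hG : Integrable (fun e => G (μ + A *ᵥ q e) * w e) ν) :
    Integrable (fun z => F z.1 * gaussianStep q w A μ S z)
      ((volume : Measure (ι → ℝ)).prod ν) := by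
  refine (integrable_prod_iff' (aestronglyMeasurable_mul_gaussianStep hq hw A μ S hF)).mpr
    ⟨ae_of_all _ fun e => ?_, hG.norm.congr (ae_of_all _ fun e => ?_)⟩
  · simpa only [gaussianStep, mul_left_comm] using (hFi (μ + A *ᵥ q e)).const_mul (w e)
  · have h0 : 0 ≤ G (μ + A *ᵥ q e) := by
      rw [← hFG]
      exact integral_nonneg fun x => mul_nonneg (hF0 x) (gaussianDensity_nonneg _ _ _)
    simp only [gaussianStep, norm_mul, Real.norm_eq_abs, abs_of_nonneg h0,
      abs_of_nonneg (hF0 _), abs_of_nonneg (gaussianDensity_nonneg _ _ _)]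
    rw [← hFG, mul_comm, ← integral_const_mul]
    exact integral_congr_ae (ae_of_all _ fun x => mul_left_comm _ _ _)

/-- Fubini. Integrability is now an assumption, so `F` may change sign, as coordinates and their
products do. -/
theorem integral_mul_gaussianStep [SFinite ν] (A : Matrix ι ι ℝ) (μ : ι → ℝ)
    {F G : (ι → ℝ) → ℝ} (hFG : ∀ t, ∫ x, F x * gaussianDensity t S x = G t)
    (hi : Integrable (fun z => F z.1 * gaussianStep q w A μ S z)
      ((volume : Measure (ι → ℝ)).prod ν)) :
    ∫ z, F z.1 * gaussianStep q w A μ S z ∂((volume : Measure (ι → ℝ)).prod ν) =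
      ∫ e, G (μ + A *ᵥ q e) * w e ∂ν := by
  rw [integral_prod_symm _ hi]
  refine integral_congr_ae (ae_of_all _ fun e => ?_)
  simp only [gaussianStep]
  rw [← hFG, mul_comm, ← integral_const_mul]
  exact integral_congr_ae (ae_of_all _ fun x => mul_left_comm _ _ _)

theorem integral_one_mul_gaussianDensity (hS : S.PosDef) (t : ι → ℝ) :
    ∫ x, (1 : ℝ) * gaussianDensity t S x = 1 := by
  simp [integral_gaussianDensity hS]

namespace FiniteMoments

variable [SFinite ν] (h : FiniteMoments ν q w) (hq : Measurable q) (hS : S.PosDef)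
  (A : Matrix ι ι ℝ) (μ : ι → ℝ)

include h hq hS

theorem gaussianStep :
    FiniteMoments ((volume : Measure (ι → ℝ)).prod ν) Prod.fst (gaussianStep q w A μ S) := by
  refine of_sq measurable_fst ?_ fun a => ?_
  · simpa using integrable_mul_gaussianStep hq h.mass.aestronglyMeasurable A μ
      (F := fun _ => 1) (G := fun _ => 1) measurable_const (fun _ => zero_le_one)
      (fun t => by simpa using (finiteMoments_gaussianDensity hS t).mass)
      (integral_one_mul_gaussianDensity hS) (by simpa using h.mass)
  · refine integrable_mul_gaussianStep hq h.mass.aestronglyMeasurable A μ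
      (F := fun x => x a ^ 2) (G := fun t => S a a + t a * t a) (by fun_prop)
      (fun _ => sq_nonneg _)
      (fun t => by simpa only [sq] using (finiteMoments_gaussianDensity hS t).second a a)
      (fun t => by simpa only [sq] using integral_coord_mul_coord_mul_gaussianDensity hS t a a) ?_
    simp only [add_mul]
    exact (h.mass.const_mul _).add (h.integrable_affine_mul_affine A μ a a)

theorem integral_gaussianStep :
    ∫ z, _root_.gaussianStep q w A μ S z ∂((volume : Measure (ι → ℝ)).prod ν) =
      ∫ e, w e ∂ν := by
  simpa using integral_mul_gaussianStep (q := q) (w := w) (ν := ν) A μ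
    (F := fun _ => 1) (G := fun _ => 1) (integral_one_mul_gaussianDensity hS)
    (by simpa using (h.gaussianStep hq hS A μ).mass)

theorem integral_coord_mul_gaussianStep (a : ι) :
    ∫ z, z.1 a * _root_.gaussianStep q w A μ S z ∂((volume : Measure (ι → ℝ)).prod ν) =
      μ a * ∫ e, w e ∂ν + ∑ i, A a i * ∫ e, q e i * w e ∂ν := by
  rw [← h.integral_affine A μ a]
  exact integral_mul_gaussianStep A μ (F := fun x => x a) (G := fun x => x a)
    (fun t => integral_coord_mul_gaussianDensity hS t a) ((h.gaussianStep hq hS A μ).first a)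

theorem integral_coord_mul_coord_mul_gaussianStep (a b : ι) :
    ∫ z, z.1 a * z.1 b * _root_.gaussianStep q w A μ S z ∂((volume : Measure (ι → ℝ)).prod ν) =
      S a b * ∫ e, w e ∂ν + (μ a * μ b * ∫ e, w e ∂ν + ∑ i, μ b * A a i * ∫ e, q e i * w e ∂ν +
        ∑ i, μ a * A b i * ∫ e, q e i * w e ∂ν +
        ∑ i, ∑ j, A a i * A b j * ∫ e, q e i * q e j * w e ∂ν) := by
  rw [← h.integral_affine_mul_affine A μ a b, ← integral_const_mul,
    ← integral_add (h.mass.const_mul _) (h.integrable_affine_mul_affine A μ a b)]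
  simp_rw [← add_mul]
  exact integral_mul_gaussianStep A μ (F := fun x => x a * x b)
    (G := fun x => S a b + x a * x b)
    (fun t => integral_coord_mul_coord_mul_gaussianDensity hS t a b)
    ((h.gaussianStep hq hS A μ).second a b)

end FiniteMoments

end GaussianStep

/-! ### One-step factorization of the joint density -/

namespace CondGaussianPMC

variable {m p K : ℕ} (M : CondGaussianPMC m p K)

theorem trans_nonneg (k : ℕ) (i j : Fin K) (x' : Fin m → ℝ) (y' : Fin p → ℝ)
    (x : Fin m → ℝ) (y : Fin p → ℝ) : 0 ≤ M.trans k i j x' y' x y :=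
  gaussianDensity_nonneg _ _ _

theorem joint_nonneg (k : ℕ) (x : Fin (k + 1) → Fin m → ℝ) (y : Fin (k + 1) → Fin p → ℝ)
    (r : Fin (k + 1) → Fin K) : 0 ≤ M.joint k x y r :=
  mul_nonneg (mul_nonneg (mul_nonneg (M.initProb_nonneg _)
    (Finset.prod_nonneg fun _ _ => M.jumpProb_nonneg _ _ _)) (M.initDensity_nonneg _ _ _))
    (Finset.prod_nonneg fun _ _ => M.trans_nonneg _ _ _ _ _ _ _)

theorem joint_zero (x : Fin 1 → Fin m → ℝ) (y : Fin 1 → Fin p → ℝ) (r : Fin 1 → Fin K) :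
    M.joint 0 x y r = M.initProb (r 0) * M.initDensity (r 0) (x 0) (y 0) := by
  simp [joint]

/-- The Markov structure: only the last factors of the two products involve time k + 1. Taking
observations as prefixes of one infinite sequence makes those of lengths k + 1 and k + 2 compatible.
-/
theorem joint_succ (k : ℕ) (x : Fin (k + 2) → Fin m → ℝ) (y : ℕ → Fin p → ℝ)
    (r : Fin (k + 2) → Fin K) :
    M.joint (k + 1) x (obs y (k + 1)) r =
      M.joint k (Fin.init x) (obs y k) (Fin.init r) *
        (M.jumpProb (k + 1) (r (Fin.last k).castSucc) (r (Fin.last (k + 1))) *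
        M.trans (k + 1) (r (Fin.last k).castSucc) (r (Fin.last (k + 1)))
          (x (Fin.last k).castSucc) (y k) (x (Fin.last (k + 1))) (y (k + 1))) := by
  simp only [joint, Fin.prod_univ_castSucc (n := k), Fin.init, obs, Fin.val_castSucc,
    Fin.succ_last, Fin.val_last, ← Fin.succ_castSucc, Fin.val_succ, Fin.castSucc_zero,
    Fin.val_zero]
  ring

variable {M} {g : ℕ → Fin K → Fin K → (Fin p → ℝ) → (Fin p → ℝ) → ℝ}
  {C : ℕ → Fin K → Fin K → Matrix (Fin m) (Fin m) ℝ}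
  {D : ℕ → Fin K → Fin K → (Fin p → ℝ) → (Fin p → ℝ) → Fin m → ℝ}
  {Sx : ℕ → Fin K → Fin K → Matrix (Fin m) (Fin m) ℝ}

/-- Bayes' rule, provided the quotient defining `transX` has a nonzero denominator. A zero
denominator would give `transX` = 0, against positivity of the Gaussian density. -/
theorem ExactFiltering.trans_eq (h : M.ExactFiltering g C D Sx) (k : ℕ) (i j : Fin K)
    (x' : Fin m → ℝ) (y' : Fin p → ℝ) (x : Fin m → ℝ) (y : Fin p → ℝ) :
    M.trans (k + 1) i j x' y' x y = g (k + 1) i j y' y *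
      gaussianDensity (D (k + 1) i j y' y + C (k + 1) i j *ᵥ x') (Sx (k + 1) i j) x := by
  have h1 := h.transX_eq k i j x' y' x y
  have h2 : M.transY (k + 1) i j x' y' y ≠ 0 := by
    intro h0
    rw [transX, h0, div_zero] at h1
    exact (gaussianDensity_pos (h.posDef_Sx k i j) _ _).ne h1
  rw [← h.transY_eq k i j x' y' y, add_comm (D (k + 1) i j y' y), ← h1, transX, mul_div_cancel₀ _ h2]

/-- The weight of a pair of regimes in the passage from time `k` to time `k + 1`. -/
noncomputable def pairWeight (M : CondGaussianPMC m p K)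
    (g : ℕ → Fin K → Fin K → (Fin p → ℝ) → (Fin p → ℝ) → ℝ) (y : ℕ → Fin p → ℝ)
    (k : ℕ) (i j : Fin K) : ℝ :=
  M.jumpProb (k + 1) i j * g (k + 1) i j (y k) (y (k + 1))

/-- The factorization of a path into its last value and its restriction to the earlier times. -/
noncomputable def splitLast (m k : ℕ) :
    (Fin (k + 2) → Fin m → ℝ) ≃ᵐ (Fin m → ℝ) × (Fin (k + 1) → Fin m → ℝ) :=
  MeasurableEquiv.piFinSuccAbove (fun _ : Fin (k + 2) => Fin m → ℝ) (Fin.last (k + 1))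

theorem splitLast_apply (k : ℕ) (x : Fin (k + 2) → Fin m → ℝ) :
    splitLast m k x = (x (Fin.last (k + 1)), Fin.init x) := by
  refine Prod.ext rfl ?_
  funext l
  simp [splitLast, MeasurableEquiv.piFinSuccAbove, Fin.init]

theorem measurePreserving_splitLast (k : ℕ) :
    MeasurePreserving (splitLast m k) volume ((volume : Measure (Fin m → ℝ)).prod volume) :=
  volume_preserving_piFinSuccAbove _ _

/-- The last two regimes are separate variables `i`, `j`, so that the coefficients stay constant
when summing over all paths with these last regimes. -/
theorem ExactFiltering.joint_succ_eq_gaussianStep (h : M.ExactFiltering g C D Sx) (k : ℕ)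
    (x : Fin (k + 2) → Fin m → ℝ) (y : ℕ → Fin p → ℝ) (r : Fin (k + 2) → Fin K) (i j : Fin K)
    (hi : r (Fin.last k).castSucc = i) (hj : r (Fin.last (k + 1)) = j) :
    M.joint (k + 1) x (obs y (k + 1)) r =
      gaussianStep (fun x' => x' (Fin.last k))
        (fun x' => pairWeight M g y k i j * M.joint k x' (obs y k) (Fin.init r))
        (C (k + 1) i j) (D (k + 1) i j (y k) (y (k + 1))) (Sx (k + 1) i j)
        (splitLast m k x) := by
  rw [joint_succ, h.trans_eq, splitLast_apply, hi, hj, gaussianStep, pairWeight]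
  simp only [Fin.init]
  ring

theorem ExactFiltering.finiteMoments_joint (h : M.ExactFiltering g C D Sx) (y : ℕ → Fin p → ℝ)
    (k : ℕ) (r : Fin (k + 1) → Fin K) :
    FiniteMoments volume (fun x : Fin (k + 1) → Fin m → ℝ => x (Fin.last k))
      (fun x => M.joint k x (obs y k) r) := by
  induction k with
  | zero =>
    simp_rw [joint_zero]
    -- A path of length one is a single state, so the moment hypotheses on the initial density apply
    -- after identifying the two spaces.
    have h0 : FiniteMoments volume (fun x : Fin m → ℝ => x)
        (fun x => M.initDensity (r 0) x (obs y 0 0)) :=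
      .of_sq measurable_id (M.initDensity_integrable _ _) (M.initDensity_moment _ _)
    exact ((h0.const_mul (M.initProb (r 0))).comp_measurePreserving
      (volume_preserving_funUnique (Fin 1) (Fin m → ℝ)))
  | succ k ih =>
    simp_rw [h.joint_succ_eq_gaussianStep k _ y r _ _ rfl rfl]
    have h1 := (((ih (Fin.init r)).const_mul (pairWeight M g y k (r (Fin.last k).castSucc)
      (r (Fin.last (k + 1))))).gaussianStep (measurable_pi_apply _)
      (h.posDef_Sx k (r (Fin.last k).castSucc) (r (Fin.last (k + 1))))
      (C (k + 1) (r (Fin.last k).castSucc) (r (Fin.last (k + 1))))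
      (D (k + 1) (r (Fin.last k).castSucc) (r (Fin.last (k + 1))) (y k) (y (k + 1))))
    have h2 := h1.comp_measurePreserving (measurePreserving_splitLast k)
    simpa only [splitLast_apply] using h2

/-! ### Integrals over state paths for a fixed regime path -/

section PathIntegrals

variable (h : M.ExactFiltering g C D Sx) (y : ℕ → Fin p → ℝ) (k : ℕ)
  (r : Fin (k + 2) → Fin K) (i j : Fin K) (hi : r (Fin.last k).castSucc = i)
  (hj : r (Fin.last (k + 1)) = j)

include h hi hj

theorem ExactFiltering.integral_mul_joint_succ (F : (Fin m → ℝ) → ℝ) :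
    ∫ x : Fin (k + 2) → Fin m → ℝ, F (x (Fin.last (k + 1))) *
        M.joint (k + 1) x (obs y (k + 1)) r =
      ∫ z, F z.1 * gaussianStep (fun x' => x' (Fin.last k))
        (fun x' => pairWeight M g y k i j * M.joint k x' (obs y k) (Fin.init r))
        (C (k + 1) i j) (D (k + 1) i j (y k) (y (k + 1))) (Sx (k + 1) i j) z
        ∂((volume : Measure (Fin m → ℝ)).prod volume) := by
  rw [← (measurePreserving_splitLast k).integral_comp (splitLast m k).measurableEmbedding]
  refine integral_congr_ae (ae_of_all _ fun x => ?_)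
  simp only [h.joint_succ_eq_gaussianStep k x y r i j hi hj, splitLast_apply]

theorem ExactFiltering.integral_joint_succ :
    ∫ x : Fin (k + 2) → Fin m → ℝ, M.joint (k + 1) x (obs y (k + 1)) r =
      pairWeight M g y k i j *
        ∫ x : Fin (k + 1) → Fin m → ℝ, M.joint k x (obs y k) (Fin.init r) := by
  have h1 := h.integral_mul_joint_succ y k r i j hi hj (fun _ => 1)
  simp only [one_mul] at h1
  rw [h1, ((h.finiteMoments_joint y k (Fin.init r)).const_mul _).integral_gaussianStep
    (measurable_pi_apply _) (h.posDef_Sx k i j), integral_const_mul]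

theorem ExactFiltering.integral_coord_joint_succ (a : Fin m) :
    ∫ x : Fin (k + 2) → Fin m → ℝ, x (Fin.last (k + 1)) a *
        M.joint (k + 1) x (obs y (k + 1)) r =
      pairWeight M g y k i j * (D (k + 1) i j (y k) (y (k + 1)) a *
        ∫ x : Fin (k + 1) → Fin m → ℝ, M.joint k x (obs y k) (Fin.init r)) +
      pairWeight M g y k i j * ∑ c, C (k + 1) i j a c *
        ∫ x : Fin (k + 1) → Fin m → ℝ, x (Fin.last k) c * M.joint k x (obs y k) (Fin.init r) := by
  rw [h.integral_mul_joint_succ y k r i j hi hj (fun x => x a),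
    ((h.finiteMoments_joint y k (Fin.init r)).const_mul _).integral_coord_mul_gaussianStep
    (measurable_pi_apply _) (h.posDef_Sx k i j)]
  simp only [mul_left_comm _ (pairWeight M g y k i j), integral_const_mul, ← Finset.mul_sum]

theorem ExactFiltering.integral_coord_coord_joint_succ (a b : Fin m) :
    ∫ x : Fin (k + 2) → Fin m → ℝ, x (Fin.last (k + 1)) a * x (Fin.last (k + 1)) b *
        M.joint (k + 1) x (obs y (k + 1)) r =
      pairWeight M g y k i j * ((Sx (k + 1) i j a b + D (k + 1) i j (y k) (y (k + 1)) a *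
          D (k + 1) i j (y k) (y (k + 1)) b) *
        ∫ x : Fin (k + 1) → Fin m → ℝ, M.joint k x (obs y k) (Fin.init r)) +
      pairWeight M g y k i j * (∑ c, (D (k + 1) i j (y k) (y (k + 1)) b * C (k + 1) i j a c +
          D (k + 1) i j (y k) (y (k + 1)) a * C (k + 1) i j b c) *
        ∫ x : Fin (k + 1) → Fin m → ℝ, x (Fin.last k) c * M.joint k x (obs y k) (Fin.init r)) +
      pairWeight M g y k i j * ∑ c, ∑ d, C (k + 1) i j a c * C (k + 1) i j b d *
        ∫ x : Fin (k + 1) → Fin m → ℝ, x (Fin.last k) c * x (Fin.last k) d *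
          M.joint k x (obs y k) (Fin.init r) := by
  rw [h.integral_mul_joint_succ y k r i j hi hj (fun x => x a * x b),
    ((h.finiteMoments_joint y k (Fin.init r)).const_mul
      _).integral_coord_mul_coord_mul_gaussianStep
    (measurable_pi_apply _) (h.posDef_Sx k i j)]
  simp only [mul_left_comm _ (pairWeight M g y k i j), integral_const_mul, ← Finset.mul_sum,
    add_mul, Finset.sum_add_distrib]
  ring

end PathIntegrals

/-! ### Sums over regime paths -/

theorem sum_path_eq_sum_sum {k : ℕ} (f : (Fin (k + 1) → Fin K) → ℝ) :
    ∑ r, f r = ∑ j, ∑ r : Fin (k + 1) → Fin K with r (Fin.last k) = j, f r :=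
  (Finset.sum_fiberwise _ _ _).symm

theorem sum_path_last_eq_sum_sum {k : ℕ} (f : (Fin (k + 2) → Fin K) → ℝ) (j : Fin K) :
    ∑ r : Fin (k + 2) → Fin K with r (Fin.last (k + 1)) = j, f r =
      ∑ i, ∑ r : Fin (k + 2) → Fin K with
        r (Fin.last k).castSucc = i ∧ r (Fin.last (k + 1)) = j, f r := by
  rw [← Finset.sum_fiberwise _ (fun r : Fin (k + 2) → Fin K => r (Fin.last k).castSucc)]
  simp only [Finset.filter_filter, and_comm]

/-- Dropping the last regime is a bijection onto the paths ending in `i`, with inverse appending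
`j`. This is what merges the regime histories. -/
theorem sum_path_pair_init {k : ℕ} (f : (Fin (k + 1) → Fin K) → ℝ) (i j : Fin K) :
    ∑ r : Fin (k + 2) → Fin K with
        r (Fin.last k).castSucc = i ∧ r (Fin.last (k + 1)) = j, f (Fin.init r) =
      ∑ r : Fin (k + 1) → Fin K with r (Fin.last k) = i, f r := by
  refine Finset.sum_nbij' (fun r => Fin.init r)
    (fun r => (Fin.snoc r j : Fin (k + 2) → Fin K)) ?_ ?_ ?_ ?_ ?_
  · intro r hr
    simp only [Finset.mem_filter, Finset.mem_univ, true_and] at hr ⊢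
    exact hr.1
  · intro r hr
    simpa using hr
  · intro r hr
    simp only [Finset.mem_filter, Finset.mem_univ, true_and] at hr
    rw [← hr.2]
    exact Fin.snoc_init_self r
  · intro r _
    exact Fin.init_snoc _ _
  · intro r _
    rfl

/-! ### Recursions for the densities and the unnormalized moments -/

theorem obsDensity_eq_sum (M : CondGaussianPMC m p K) (k : ℕ) (y : Fin (k + 1) → Fin p → ℝ) :
    M.obsDensity k y = ∑ j, M.obsRegimeDensity k y j :=
  sum_path_eq_sum_sum _

theorem obsRegimeDensity_succ_eq_sum (M : CondGaussianPMC m p K) (k : ℕ)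
    (y : Fin (k + 2) → Fin p → ℝ) (j : Fin K) :
    M.obsRegimeDensity (k + 1) y j = ∑ i, M.obsPairDensity k y i j :=
  sum_path_last_eq_sum_sum _ _

theorem obsRegimeDensity_nonneg (M : CondGaussianPMC m p K) (k : ℕ)
    (y : Fin (k + 1) → Fin p → ℝ) (j : Fin K) : 0 ≤ M.obsRegimeDensity k y j :=
  Finset.sum_nonneg fun _ _ => integral_nonneg fun _ => M.joint_nonneg _ _ _ _

theorem obsRegimeDensity_eq_zero (M : CondGaussianPMC m p K) (k : ℕ)
    (y : Fin (k + 1) → Fin p → ℝ) (h : M.obsDensity k y = 0) (j : Fin K) :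
    M.obsRegimeDensity k y j = 0 := by
  rw [obsDensity_eq_sum,
    Finset.sum_eq_zero_iff_of_nonneg fun j _ => M.obsRegimeDensity_nonneg k y j] at h
  exact h j (Finset.mem_univ j)

/-- The numerator of `E(f(x_k) | y_{0:k}, r_k = j)`. -/
noncomputable def rawExpect (M : CondGaussianPMC m p K) (k : ℕ) (y : Fin (k + 1) → Fin p → ℝ)
    (j : Fin K) (f : (Fin m → ℝ) → ℝ) : ℝ :=
  ∑ r : Fin (k + 1) → Fin K with r (Fin.last k) = j,
    ∫ x : Fin (k + 1) → Fin m → ℝ, f (x (Fin.last k)) * M.joint k x y r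

theorem regimeExpect_eq (M : CondGaussianPMC m p K) (k : ℕ) (y : Fin (k + 1) → Fin p → ℝ)
    (j : Fin K) (f : (Fin m → ℝ) → ℝ) :
    M.regimeExpect k y j f = M.rawExpect k y j f / M.obsRegimeDensity k y j := rfl

theorem obsExpect_eq (M : CondGaussianPMC m p K) (k : ℕ) (y : Fin (k + 1) → Fin p → ℝ)
    (f : (Fin m → ℝ) → ℝ) :
    M.obsExpect k y f = (∑ j, M.rawExpect k y j f) / M.obsDensity k y := by
  rw [obsExpect, sum_path_eq_sum_sum]
  rfl

namespace ExactFiltering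

variable (h : M.ExactFiltering g C D Sx) (y : ℕ → Fin p → ℝ) (k : ℕ)

include h

/-- Clearing the denominator is legitimate even when it is zero: the joint density is then almost
everywhere zero on each path concerned, so the numerator vanishes too. -/
theorem rawExpect_eq (j : Fin K) (f : (Fin m → ℝ) → ℝ) :
    M.rawExpect k (obs y k) j f =
      M.obsRegimeDensity k (obs y k) j * M.regimeExpect k (obs y k) j f := by
  rw [regimeExpect_eq]
  by_cases h0 : M.obsRegimeDensity k (obs y k) j = 0
  · rw [h0, zero_mul, rawExpect]
    refine Finset.sum_eq_zero fun r hr => ?_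
    rw [obsRegimeDensity, Finset.sum_eq_zero_iff_of_nonneg fun r _ =>
      integral_nonneg fun x => M.joint_nonneg _ _ _ _] at h0
    exact (h.finiteMoments_joint y k r).integral_mul_eq_zero
      (fun x => M.joint_nonneg _ _ _ _) (h0 r hr) _
  · rw [mul_div_cancel₀ _ h0]

theorem obsPairDensity_eq (i j : Fin K) :
    M.obsPairDensity k (obs y (k + 1)) i j =
      pairWeight M g y k i j * M.obsRegimeDensity k (obs y k) i := by
  rw [obsPairDensity, obsRegimeDensity, Finset.mul_sum, ← sum_path_pair_init _ i j]
  refine Finset.sum_congr rfl fun r hr => ?_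
  simp only [Finset.mem_filter, Finset.mem_univ, true_and] at hr
  exact h.integral_joint_succ y k r i j hr.1 hr.2

theorem rawExpect_coord_succ (j : Fin K) (a : Fin m) :
    M.rawExpect (k + 1) (obs y (k + 1)) j (fun x => x a) =
      ∑ i, M.obsPairDensity k (obs y (k + 1)) i j *
        (C (k + 1) i j *ᵥ M.regimeMean k (obs y k) i + D (k + 1) i j (y k) (y (k + 1))) a := by
  rw [rawExpect, sum_path_last_eq_sum_sum]
  refine Finset.sum_congr rfl fun i _ => ?_
  have h1 : ∀ c, M.rawExpect k (obs y k) i (fun x => x c) =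
      M.obsRegimeDensity k (obs y k) i * M.regimeMean k (obs y k) i c :=
    fun c => h.rawExpect_eq y k i _
  -- The path integral depends on `r` only through `Fin.init r` once `i` and `j` are fixed, so the
  -- sum passes to paths one step shorter; it is then exchanged with the sum over coordinates.
  rw [Finset.sum_congr rfl fun r hr => h.integral_coord_joint_succ y k r i j
    (Finset.mem_filter.mp hr).2.1 (Finset.mem_filter.mp hr).2.2 a,
    sum_path_pair_init (fun r => pairWeight M g y k i j * (D (k + 1) i j (y k) (y (k + 1)) a *
        ∫ x : Fin (k + 1) → Fin m → ℝ, M.joint k x (obs y k) r) +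
      pairWeight M g y k i j * ∑ c, C (k + 1) i j a c *
        ∫ x : Fin (k + 1) → Fin m → ℝ, x (Fin.last k) c * M.joint k x (obs y k) r),
    Finset.sum_add_distrib, ← Finset.mul_sum, ← Finset.mul_sum, ← Finset.mul_sum,
    Finset.sum_comm, h.obsPairDensity_eq]
  simp_rw [← Finset.mul_sum]
  have h2 : ∑ c, C (k + 1) i j a c * M.rawExpect k (obs y k) i (fun x => x c) =
      M.obsRegimeDensity k (obs y k) i * (C (k + 1) i j *ᵥ M.regimeMean k (obs y k) i) a := by
    simp_rw [h1, mulVec, dotProduct, Finset.mul_sum]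
    exact Finset.sum_congr rfl fun c _ => by ring
  simp only [rawExpect] at h2
  rw [h2, Pi.add_apply, obsRegimeDensity]
  ring

theorem rawExpect_coord_coord_succ (j : Fin K) (a b : Fin m) :
    M.rawExpect (k + 1) (obs y (k + 1)) j (fun x => x a * x b) =
      ∑ i, M.obsPairDensity k (obs y (k + 1)) i j *
        (Sx (k + 1) i j +
          C (k + 1) i j * M.regimeSecond k (obs y k) i * (C (k + 1) i j)ᵀ +
          vecMulVec (D (k + 1) i j (y k) (y (k + 1))) (M.regimeMean k (obs y k) i) *
            (C (k + 1) i j)ᵀ +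
          C (k + 1) i j *
            vecMulVec (M.regimeMean k (obs y k) i) (D (k + 1) i j (y k) (y (k + 1))) +
          vecMulVec (D (k + 1) i j (y k) (y (k + 1)))
            (D (k + 1) i j (y k) (y (k + 1)))) a b := by
  rw [rawExpect, sum_path_last_eq_sum_sum]
  refine Finset.sum_congr rfl fun i _ => ?_
  have h1 : ∀ c, M.rawExpect k (obs y k) i (fun x => x c) =
      M.obsRegimeDensity k (obs y k) i * M.regimeMean k (obs y k) i c :=
    fun c => h.rawExpect_eq y k i _
  have h2 : ∀ c d, M.rawExpect k (obs y k) i (fun x => x c * x d) =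
      M.obsRegimeDensity k (obs y k) i * M.regimeSecond k (obs y k) i c d :=
    fun c d => h.rawExpect_eq y k i _
  rw [Finset.sum_congr rfl fun r hr => h.integral_coord_coord_joint_succ y k r i j
    (Finset.mem_filter.mp hr).2.1 (Finset.mem_filter.mp hr).2.2 a b,
    sum_path_pair_init (fun r => pairWeight M g y k i j * ((Sx (k + 1) i j a b +
          D (k + 1) i j (y k) (y (k + 1)) a * D (k + 1) i j (y k) (y (k + 1)) b) *
        ∫ x : Fin (k + 1) → Fin m → ℝ, M.joint k x (obs y k) r) +
      pairWeight M g y k i j * (∑ c, (D (k + 1) i j (y k) (y (k + 1)) b * C (k + 1) i j a c +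
          D (k + 1) i j (y k) (y (k + 1)) a * C (k + 1) i j b c) *
        ∫ x : Fin (k + 1) → Fin m → ℝ, x (Fin.last k) c * M.joint k x (obs y k) r) +
      pairWeight M g y k i j * ∑ c, ∑ d, C (k + 1) i j a c * C (k + 1) i j b d *
        ∫ x : Fin (k + 1) → Fin m → ℝ, x (Fin.last k) c * x (Fin.last k) d *
          M.joint k x (obs y k) r),
    Finset.sum_add_distrib, Finset.sum_add_distrib, ← Finset.mul_sum, ← Finset.mul_sum,
    ← Finset.mul_sum, ← Finset.mul_sum, Finset.sum_comm, h.obsPairDensity_eq]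
  have h3 : ∀ c d, ∑ r : Fin (k + 1) → Fin K with r (Fin.last k) = i,
      ∫ x : Fin (k + 1) → Fin m → ℝ, x (Fin.last k) c * x (Fin.last k) d *
        M.joint k x (obs y k) r = _ := h2
  have h4 : ∀ c, ∑ r : Fin (k + 1) → Fin K with r (Fin.last k) = i,
      ∫ x : Fin (k + 1) → Fin m → ℝ, x (Fin.last k) c * M.joint k x (obs y k) r = _ := h1
  have h5 : ∑ r : Fin (k + 1) → Fin K with r (Fin.last k) = i,
      ∑ c, ∑ d, C (k + 1) i j a c * C (k + 1) i j b d *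
        ∫ x : Fin (k + 1) → Fin m → ℝ, x (Fin.last k) c * x (Fin.last k) d *
          M.joint k x (obs y k) r =
      ∑ c, ∑ d, C (k + 1) i j a c * C (k + 1) i j b d *
        (M.obsRegimeDensity k (obs y k) i * M.regimeSecond k (obs y k) i c d) := by
    rw [Finset.sum_comm]
    refine Finset.sum_congr rfl fun c _ => ?_
    rw [Finset.sum_comm]
    refine Finset.sum_congr rfl fun d _ => ?_
    rw [← Finset.mul_sum, h3]
  have h7 : ∑ r : Fin (k + 1) → Fin K with r (Fin.last k) = i,
      ∫ x : Fin (k + 1) → Fin m → ℝ, M.joint k x (obs y k) r =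
      M.obsRegimeDensity k (obs y k) i := rfl
  simp_rw [h5, ← Finset.mul_sum, h4, h7]
  have h6 : (C (k + 1) i j * M.regimeSecond k (obs y k) i * (C (k + 1) i j)ᵀ) a b =
      ∑ c, ∑ d, C (k + 1) i j a c * C (k + 1) i j b d * M.regimeSecond k (obs y k) i c d := by
    simp only [mul_apply, transpose_apply, Finset.sum_mul]
    rw [Finset.sum_comm]
    exact Finset.sum_congr rfl fun c _ => Finset.sum_congr rfl fun d _ => by ring
  simp only [Matrix.add_apply, h6]
  simp only [mul_apply, transpose_apply, vecMulVec_apply, mul_add, add_mul, Finset.mul_sum,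
    Finset.sum_add_distrib]
  simp only [mul_comm, mul_left_comm]
  ring_nf

end ExactFiltering

end CondGaussianPMC

/-! ### Normalized recursions for the conditional quantities -/

namespace CondGaussianPMC

variable {m p K : ℕ} {M : CondGaussianPMC m p K}
  {g : ℕ → Fin K → Fin K → (Fin p → ℝ) → (Fin p → ℝ) → ℝ}
  {C : ℕ → Fin K → Fin K → Matrix (Fin m) (Fin m) ℝ}
  {D : ℕ → Fin K → Fin K → (Fin p → ℝ) → (Fin p → ℝ) → Fin m → ℝ}
  {Sx : ℕ → Fin K → Fin K → Matrix (Fin m) (Fin m) ℝ}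

namespace ExactFiltering

variable (h : M.ExactFiltering g C D Sx) (y : ℕ → Fin p → ℝ) (k : ℕ)

include h

theorem regimeProb_succ (j : Fin K) :
    M.regimeProb (k + 1) (obs y (k + 1)) j =
      (∑ i, M.jumpProb (k + 1) i j * g (k + 1) i j (y k) (y (k + 1)) *
        M.regimeProb k (obs y k) i) /
      ∑ j', ∑ i, M.jumpProb (k + 1) i j' * g (k + 1) i j' (y k) (y (k + 1)) *
        M.regimeProb k (obs y k) i := by
  simp only [regimeProb, obsDensity_eq_sum M (k + 1), obsRegimeDensity_succ_eq_sum,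
    h.obsPairDensity_eq, pairWeight, mul_div_assoc', ← Finset.sum_div]
  -- If p(y_{0:k}) = 0, all regime densities vanish and both sides are 0/0 = 0; otherwise the common
  -- normalizer cancels.
  by_cases h0 : M.obsDensity k (obs y k) = 0
  · simp [M.obsRegimeDensity_eq_zero k _ h0]
  · rw [div_div_div_cancel_right₀ h0]

theorem backProb_eq (i j : Fin K) :
    M.backProb k (obs y (k + 1)) i j =
      (M.jumpProb (k + 1) i j * g (k + 1) i j (y k) (y (k + 1)) *
        M.regimeProb k (obs y k) i) /
      ∑ i', M.jumpProb (k + 1) i' j * g (k + 1) i' j (y k) (y (k + 1)) *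
        M.regimeProb k (obs y k) i' := by
  simp only [regimeProb, backProb, obsRegimeDensity_succ_eq_sum,
    h.obsPairDensity_eq, pairWeight, mul_div_assoc', ← Finset.sum_div]
  by_cases h0 : M.obsDensity k (obs y k) = 0
  · simp [M.obsRegimeDensity_eq_zero k _ h0]
  · rw [div_div_div_cancel_right₀ h0]

theorem regimeMean_succ (j : Fin K) :
    M.regimeMean (k + 1) (obs y (k + 1)) j =
      ∑ i, M.backProb k (obs y (k + 1)) i j •
        (C (k + 1) i j *ᵥ M.regimeMean k (obs y k) i +
          D (k + 1) i j (y k) (y (k + 1))) := by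
  funext a
  rw [regimeMean, regimeExpect_eq, h.rawExpect_coord_succ, Finset.sum_div, Finset.sum_apply]
  refine Finset.sum_congr rfl fun i _ => ?_
  rw [Pi.smul_apply, smul_eq_mul, backProb, mul_div_right_comm]

theorem regimeSecond_succ (j : Fin K) :
    M.regimeSecond (k + 1) (obs y (k + 1)) j =
      ∑ i, M.backProb k (obs y (k + 1)) i j •
        (Sx (k + 1) i j +
          C (k + 1) i j * M.regimeSecond k (obs y k) i * (C (k + 1) i j)ᵀ +
          vecMulVec (D (k + 1) i j (y k) (y (k + 1))) (M.regimeMean k (obs y k) i) *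
            (C (k + 1) i j)ᵀ +
          C (k + 1) i j *
            vecMulVec (M.regimeMean k (obs y k) i) (D (k + 1) i j (y k) (y (k + 1))) +
          vecMulVec (D (k + 1) i j (y k) (y (k + 1)))
            (D (k + 1) i j (y k) (y (k + 1)))) := by
  ext a b
  rw [regimeSecond, Matrix.of_apply, regimeExpect_eq, h.rawExpect_coord_coord_succ,
    Finset.sum_div, Matrix.sum_apply]
  refine Finset.sum_congr rfl fun i _ => ?_
  rw [Matrix.smul_apply, smul_eq_mul, backProb, mul_div_right_comm]

theorem obsExpect_eq_sum (f : (Fin m → ℝ) → ℝ) :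
    M.obsExpect k (obs y k) f =
      ∑ j, M.regimeProb k (obs y k) j * M.regimeExpect k (obs y k) j f := by
  rw [obsExpect_eq, Finset.sum_div]
  refine Finset.sum_congr rfl fun j _ => ?_
  rw [h.rawExpect_eq, regimeProb, mul_div_right_comm]

theorem obsMean_eq_sum :
    M.obsMean k (obs y k) = ∑ j, M.regimeProb k (obs y k) j • M.regimeMean k (obs y k) j := by
  funext a
  rw [Finset.sum_apply]
  exact h.obsExpect_eq_sum y k _

theorem obsSecond_eq_sum :
    M.obsSecond k (obs y k) =
      ∑ j, M.regimeProb k (obs y k) j • M.regimeSecond k (obs y k) j := by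
  ext a b
  simp only [Matrix.sum_apply, Matrix.smul_apply, smul_eq_mul]
  exact h.obsExpect_eq_sum y k fun x => x a * x b

end ExactFiltering

end CondGaussianPMC

/-! ### The filtering program -/

namespace ArithFormula

/-- A formula for a finite sum. -/
def sum {ι : Type} : {n : ℕ} → (Fin n → ArithFormula ι) → ArithFormula ι
  | 0, _ => const 0
  | _ + 1, f => add (f 0) (sum fun i => f i.succ)

@[simp]
theorem eval_sum {ι : Type} (v : ι → ℝ) {n : ℕ} (f : Fin n → ArithFormula ι) :
    (sum f).eval v = ∑ i, (f i).eval v := by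
  induction n with
  | zero => simp [sum, eval]
  | succ n ih => simp [sum, eval, ih, Fin.sum_univ_succ]

end ArithFormula

namespace FilterProgram

open ArithFormula

variable (m K : ℕ)

/-- `p(r_k = j | r_{k-1} = i) p(y_k | y_{k-1}, r_{k-1:k}) p(r_{k-1} = i | y_{0:k-1})` -/
def weightFormula (i j : Fin K) : ArithFormula (FilterInput m K) :=
  mul (mul (input (.jump i j)) (input (.lik i j))) (input (.prob i))

/-- `p(r_k = j | y_{0:k})` -/
def probFormula (j : Fin K) : ArithFormula (FilterInput m K) :=
  div (sum fun i => weightFormula m K i j) (sum fun j' => sum fun i => weightFormula m K i j')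

/-- `p(r_{k-1} = i | r_k = j, y_{0:k})` -/
def backFormula (i j : Fin K) : ArithFormula (FilterInput m K) :=
  div (weightFormula m K i j) (sum fun i' => weightFormula m K i' j)

/-- The entries of `E(x_k | y_{0:k}, r_k = j)`. -/
def meanFormula (j : Fin K) (a : Fin m) : ArithFormula (FilterInput m K) :=
  sum fun i => mul (backFormula m K i j)
    (add (sum fun c => mul (input (.matC i j a c)) (input (.mean i c))) (input (.vecD i j a)))

/-- The entries of `E(x_k x_kᵀ | y_{0:k}, r_k = j)`. -/
def secondFormula (j : Fin K) (a b : Fin m) : ArithFormula (FilterInput m K) :=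
  sum fun i => mul (backFormula m K i j)
    (add (add (add (add (input (.matSx i j a b))
      (sum fun d => mul (sum fun c => mul (input (.matC i j a c)) (input (.second i c d)))
        (input (.matC i j b d))))
      (sum fun c => mul (mul (input (.vecD i j a)) (input (.mean i c))) (input (.matC i j b c))))
      (sum fun c => mul (input (.matC i j a c)) (mul (input (.mean i c)) (input (.vecD i j b)))))
      (mul (input (.vecD i j a)) (input (.vecD i j b))))

/-- One time step of the exact filter. -/
def exactFilter : FilterProgram m K where
  prob := probFormula m K
  mean := meanFormula m K
  second := secondFormula m K
  -- Formulas read only values stored at the previous time, so the new probabilities and moments are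
  -- recomputed inside; this affects only the constant in the cost.
  phiMean a := sum fun j => mul (probFormula m K j) (meanFormula m K j a)
  phiSecond a b := sum fun j => mul (probFormula m K j) (secondFormula m K j a b)

variable {m K}

theorem run_cost (P : FilterProgram m K) (v : ℕ → FilterState m K → FilterInput m K → ℝ)
    (s₀ : FilterState m K) (n : ℕ) : (P.run v s₀ n).2 = P.cost * n := by
  induction n with
  | zero => rfl
  | succ n ih => rw [run, ih, Nat.mul_succ]

end FilterProgram

/-! ### Correctness of the filtering program -/

namespace CondGaussianPMC

variable {m p K : ℕ} {M : CondGaussianPMC m p K}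
  {g : ℕ → Fin K → Fin K → (Fin p → ℝ) → (Fin p → ℝ) → ℝ}
  {C : ℕ → Fin K → Fin K → Matrix (Fin m) (Fin m) ℝ}
  {D : ℕ → Fin K → Fin K → (Fin p → ℝ) → (Fin p → ℝ) → Fin m → ℝ}
  {Sx : ℕ → Fin K → Fin K → Matrix (Fin m) (Fin m) ℝ}

namespace ExactFiltering

variable (h : M.ExactFiltering g C D Sx) (y : ℕ → Fin p → ℝ) (k : ℕ)

include h

theorem eval_probFormula (j : Fin K) :
    (FilterProgram.probFormula m K j).eval
        (M.filterInput g C D Sx y (k + 1) (M.exactState y k)) =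
      M.regimeProb (k + 1) (obs y (k + 1)) j := by
  rw [h.regimeProb_succ]
  simp [FilterProgram.probFormula, FilterProgram.weightFormula, ArithFormula.eval, filterInput,
    exactState]

theorem eval_backFormula (i j : Fin K) :
    (FilterProgram.backFormula m K i j).eval
        (M.filterInput g C D Sx y (k + 1) (M.exactState y k)) =
      M.backProb k (obs y (k + 1)) i j := by
  rw [h.backProb_eq]
  simp [FilterProgram.backFormula, FilterProgram.weightFormula, ArithFormula.eval, filterInput,
    exactState]

theorem eval_meanFormula (j : Fin K) (a : Fin m) :
    (FilterProgram.meanFormula m K j a).eval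
        (M.filterInput g C D Sx y (k + 1) (M.exactState y k)) =
      M.regimeMean (k + 1) (obs y (k + 1)) j a := by
  rw [h.regimeMean_succ]
  simp only [FilterProgram.meanFormula, ArithFormula.eval, ArithFormula.eval_sum,
    h.eval_backFormula, Finset.sum_apply, Pi.smul_apply, smul_eq_mul]
  simp [filterInput, exactState, mulVec, dotProduct]

theorem eval_secondFormula (j : Fin K) (a b : Fin m) :
    (FilterProgram.secondFormula m K j a b).eval
        (M.filterInput g C D Sx y (k + 1) (M.exactState y k)) =
      M.regimeSecond (k + 1) (obs y (k + 1)) j a b := by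
  rw [h.regimeSecond_succ, Matrix.sum_apply]
  simp only [FilterProgram.secondFormula, ArithFormula.eval, ArithFormula.eval_sum,
    h.eval_backFormula, Matrix.smul_apply, smul_eq_mul]
  simp [filterInput, exactState, Matrix.mul_apply, vecMulVec_apply]

theorem exec_exactFilter :
    (FilterProgram.exactFilter m K).exec
        (M.filterInput g C D Sx y (k + 1) (M.exactState y k)) = M.exactState y (k + 1) := by
  ext j
  · exact h.eval_probFormula y k j
  · exact h.eval_meanFormula y k j _
  · exact h.eval_secondFormula y k j _ _
  · simp only [FilterProgram.exec, FilterProgram.exactFilter, ArithFormula.eval,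
      ArithFormula.eval_sum, h.eval_probFormula, h.eval_meanFormula]
    simp [exactState, h.obsMean_eq_sum]
  · simp only [FilterProgram.exec, FilterProgram.exactFilter, ArithFormula.eval,
      ArithFormula.eval_sum, h.eval_probFormula, h.eval_secondFormula, Matrix.of_apply]
    simp [exactState, h.obsSecond_eq_sum, Matrix.sum_apply]

theorem run_exactFilter (n : ℕ) :
    ((FilterProgram.exactFilter m K).run (M.filterInput g C D Sx y) (M.exactState y 0) n).1 =
      M.exactState y n := by
  induction n with
  | zero => rfl
  | succ n ih => rw [FilterProgram.run, ih, h.exec_exactFilter]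

end ExactFiltering

end CondGaussianPMC

theorem mainTheorem1 (m p K : ℕ) :
    -- the exact recursions
    (∀ (M : CondGaussianPMC m p K)
      (g : ℕ → Fin K → Fin K → (Fin p → ℝ) → (Fin p → ℝ) → ℝ)
      (C : ℕ → Fin K → Fin K → Matrix (Fin m) (Fin m) ℝ)
      (D : ℕ → Fin K → Fin K → (Fin p → ℝ) → (Fin p → ℝ) → Fin m → ℝ)
      (Sx : ℕ → Fin K → Fin K → Matrix (Fin m) (Fin m) ℝ),
      M.ExactFiltering g C D Sx →
      ∀ y : ℕ → Fin p → ℝ,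
        -- all the integrals that define the conditional quantities converge
        (∀ (k : ℕ) (r : Fin (k + 1) → Fin K),
          Integrable (fun x : Fin (k + 1) → Fin m → ℝ => M.joint k x (obs y k) r) ∧
          (∀ a, Integrable (fun x : Fin (k + 1) → Fin m → ℝ =>
            x (Fin.last k) a * M.joint k x (obs y k) r)) ∧
          (∀ a b, Integrable (fun x : Fin (k + 1) → Fin m → ℝ =>
            x (Fin.last k) a * x (Fin.last k) b * M.joint k x (obs y k) r))) ∧
        (∀ (k : ℕ) (j : Fin K),
          M.regimeProb (k + 1) (obs y (k + 1)) j =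
            (∑ i, M.jumpProb (k + 1) i j * g (k + 1) i j (y k) (y (k + 1)) *
              M.regimeProb k (obs y k) i) /
            ∑ j', ∑ i, M.jumpProb (k + 1) i j' * g (k + 1) i j' (y k) (y (k + 1)) *
              M.regimeProb k (obs y k) i) ∧
        (∀ (k : ℕ) (i j : Fin K),
          M.backProb k (obs y (k + 1)) i j =
            (M.jumpProb (k + 1) i j * g (k + 1) i j (y k) (y (k + 1)) *
              M.regimeProb k (obs y k) i) /
            ∑ i', M.jumpProb (k + 1) i' j * g (k + 1) i' j (y k) (y (k + 1)) *
              M.regimeProb k (obs y k) i') ∧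
        (∀ (k : ℕ) (j : Fin K),
          M.regimeMean (k + 1) (obs y (k + 1)) j =
            ∑ i, M.backProb k (obs y (k + 1)) i j •
              (C (k + 1) i j *ᵥ M.regimeMean k (obs y k) i +
                D (k + 1) i j (y k) (y (k + 1)))) ∧
        (∀ (k : ℕ) (j : Fin K),
          M.regimeSecond (k + 1) (obs y (k + 1)) j =
            ∑ i, M.backProb k (obs y (k + 1)) i j •
              (Sx (k + 1) i j +
                C (k + 1) i j * M.regimeSecond k (obs y k) i * (C (k + 1) i j)ᵀ +
                vecMulVec (D (k + 1) i j (y k) (y (k + 1))) (M.regimeMean k (obs y k) i) *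
                  (C (k + 1) i j)ᵀ +
                C (k + 1) i j *
                  vecMulVec (M.regimeMean k (obs y k) i) (D (k + 1) i j (y k) (y (k + 1))) +
                vecMulVec (D (k + 1) i j (y k) (y (k + 1)))
                  (D (k + 1) i j (y k) (y (k + 1))))) ∧
        (∀ k : ℕ,
          M.obsMean k (obs y k) =
            ∑ j, M.regimeProb k (obs y k) j • M.regimeMean k (obs y k) j ∧
          M.obsSecond k (obs y k) =
            ∑ j, M.regimeProb k (obs y k) j • M.regimeSecond k (obs y k) j)) ∧
    -- exact filtering at a cost that is linear in the number of observations
    (∃ (P : FilterProgram m K) (c : ℕ),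
      ∀ (M : CondGaussianPMC m p K)
        (g : ℕ → Fin K → Fin K → (Fin p → ℝ) → (Fin p → ℝ) → ℝ)
        (C : ℕ → Fin K → Fin K → Matrix (Fin m) (Fin m) ℝ)
        (D : ℕ → Fin K → Fin K → (Fin p → ℝ) → (Fin p → ℝ) → Fin m → ℝ)
        (Sx : ℕ → Fin K → Fin K → Matrix (Fin m) (Fin m) ℝ),
        M.ExactFiltering g C D Sx →
        ∀ (y : ℕ → Fin p → ℝ) (n : ℕ),
          (P.run (M.filterInput g C D Sx y) (M.exactState y 0) n).1 = M.exactState y n ∧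
          (P.run (M.filterInput g C D Sx y) (M.exactState y 0) n).2 ≤ c * n) := by
  refine ⟨fun M g C D Sx h y => ⟨fun k r => ?_, h.regimeProb_succ y, h.backProb_eq y,
    h.regimeMean_succ y, h.regimeSecond_succ y,
    fun k => ⟨h.obsMean_eq_sum y k, h.obsSecond_eq_sum y k⟩⟩,
    -- The constant is the cost of one execution; it is chosen before the model and the
    -- observations, and the bound holds with equality.
    FilterProgram.exactFilter m K, (FilterProgram.exactFilter m K).cost,
    fun M g C D Sx h y n => ⟨h.run_exactFilter y n, (FilterProgram.run_cost _ _ _ n).le⟩⟩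
  exact ⟨(h.finiteMoments_joint y k r).mass, (h.finiteMoments_joint y k r).first,
    (h.finiteMoments_joint y k r).second⟩
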